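/- **Definitions.** A gyrogroup is a set $G$ with a binary operation $\oplus$, a two-sided identity element $1$ ($1\oplus g=g=g\oplus 1$ for all $g$), a two-sided inverse $\ominus g$ of each $g\in G$ ($\ominus g\oplus g=1=g\oplus(\ominus g)$), and, for all $g,h\in G$, an automorphism $\mathrm{gyr}[g,h]$ of $(G,\oplus)$ such that $g\oplus(h\oplus f)=(g\oplus h)\oplus \mathrm{gyr}[g,h](f)$ for all $f\in G$ and $\mathrm{gyr}[g,h]=\mathrm{gyr}[g\oplus h,h]$. A strongly topological gyrogroup is a gyrogroup $G$ with a topology $\mathcal T$ for which $\oplus\colon G\times G\to G$ and $\ominus\colon G\to G$ are continuous and for which $1$ has a neighborhood base $\mathcal U$ with $\mathrm{gyr}[x,y](U)=U$ for all $x,y\in G$ and $U\in\mathcal U$. The space $G$ is topologically orderable if $\mathcal T$ is the order topology of some total order on $G$. It is totally disconnected if its connected components are singletons. $\dim$ is the covering dimension: for a nonempty space $X$, $\dim X\le n$ means that every finite cover of $X$ by functionally open sets (sets $\{x: f(x)\neq 0\}$ with $f\colon X\to\mathbb R$ continuous) has a finite refinement that is a cover by functionally open sets and in which each point lies in at most $n+1$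 members. A family $\mathcal V$ of sets refines a family $\mathcal W$ if every member of $\mathcal V$ is contained in a member of $\mathcal W$. **Theorem.** Let $G$ be a strongly topological gyrogroup whose topology $\mathcal T$ is $T_0$ (in particular, any Hausdorff strongly topological gyrogroup). Then the following statements are equivalent: 1. $G$ is topologically orderable and totally disconnected. 2. $G$ is topologically orderable and $\dim G=0$. 3. There are an ordinal $\alpha$ and partitions $\mathcal V_\tau$ ($\tau<\alpha$) of $G$ into nonempty clopen sets such that $\mathcal V_\tau$ refines $\mathcal V_\sigma$ whenever $\sigma<\tau<\alpha$, and $\bigcup_{\tau<\alpha}\mathcal V_\tau$ is a base for $\mathcal T$. -/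

import Mathlib

open Set Topology

universe u

/-- A gyrogroup, written additively: `+` is the gyrogroup operation `⊕`, `-` the inversion `⊖`, and
`0` the identity element. The gyration `gyr a b` is an automorphism of the magma `(G, +)`.
Uniqueness of the identity, of inverses and of `gyr` follows from these axioms. -/
class Gyrogroup (G : Type u) extends Add G, Zero G, Neg G where
  gyr : G → G → (G ≃+ G)
  zero_add' : ∀ a : G, 0 + a = a
  add_zero' : ∀ a : G, a + 0 = a
  neg_add' : ∀ a : G, -a + a = 0
  add_neg' : ∀ a : G, a + -a = 0
  gyr_assoc : ∀ a b c : G, a + (b + c) = (a + b) + gyr a b c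
  gyr_loop : ∀ a b : G, gyr a b = gyr (a + b) b

/-- A topological gyrogroup: a gyrogroup with a topology making the operation (jointly) and the
inversion continuous. -/
class IsTopologicalGyrogroup (G : Type u) [Gyrogroup G] [TopologicalSpace G] : Prop
    extends ContinuousAdd G, ContinuousNeg G

/-- A strongly topological gyrogroup: a topological gyrogroup with a neighborhood base of the
identity consisting of sets that are invariant under all gyrations. -/
class IsStronglyTopologicalGyrogroup (G : Type u) [Gyrogroup G] [TopologicalSpace G] : Prop
    extends IsTopologicalGyrogroup G where
  exists_gyr_invariant_basis : ∃ 𝒰 : Set (Set G), (𝓝 (0 : G)).HasBasis (fun U => U ∈ 𝒰) id ∧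
    ∀ U ∈ 𝒰, ∀ x y : G, Gyrogroup.gyr x y '' U = U

/-- The topology is the order topology of some total order. -/
def IsTopologicallyOrderable (X : Type u) [TopologicalSpace X] : Prop :=
  ∃ o : LinearOrder X, @OrderTopology X _ o.toPreorder

/-- `𝒱` refines `𝒲`: every member of `𝒱` lies in some member of `𝒲`. -/
def FamilyRefines {X : Type u} (𝒱 𝒲 : Set (Set X)) : Prop :=
  ∀ V ∈ 𝒱, ∃ W ∈ 𝒲, V ⊆ W

/-- Functionally open (cozero) sets: complements of zero sets of continuous real functions. -/
def IsFunctionallyOpen {X : Type u} [TopologicalSpace X] (U : Set X) : Prop :=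
  ∃ f : X → ℝ, Continuous f ∧ U = {x | f x ≠ 0}

/-- A finite cover of the space by functionally open sets. -/
structure IsFiniteFunctionallyOpenCover {X : Type u} [TopologicalSpace X]
    (𝒰 : Set (Set X)) : Prop where
  finite : 𝒰.Finite
  functionallyOpen : ∀ U ∈ 𝒰, IsFunctionallyOpen U
  cover : ⋃₀ 𝒰 = univ

/-- `dim X ≤ n` for a natural number `n`: every finite functionally open cover has a finite
functionally open refinement of order at most `n`, i.e. each point lies in at most `n + 1` members
of the refinement. For normal spaces "functionally open" may be replaced by "open". -/
def CoveringDimLE (X : Type u) [TopologicalSpace X] (n : ℕ) : Prop :=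
  ∀ 𝒰 : Set (Set X), IsFiniteFunctionallyOpenCover 𝒰 →
    ∃ 𝒱 : Set (Set X), IsFiniteFunctionallyOpenCover 𝒱 ∧ FamilyRefines 𝒱 𝒰 ∧
      ∀ x : X, {V ∈ 𝒱 | x ∈ V}.encard ≤ n + 1

open Classical in
/-- The covering dimension `dim X`. It is `⊥` (standing for the conventional value `-1`) if `X` is
empty, otherwise the least natural number `n` with `dim X ≤ n`, and `⊤` (infinity) if there is no
such `n`. -/
noncomputable def coveringDim (X : Type u) [TopologicalSpace X] : WithBot ℕ∞ :=
  if IsEmpty X then ⊥ else ((⨅ n : {n : ℕ // CoveringDimLE X n}, (n.1 : ℕ∞) : ℕ∞) : WithBot ℕ∞)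

/-- There is a base of the topology that is the union of a family `V τ`, indexed by the ordinals
`τ < α`, of partitions of the space into (nonempty) clopen sets, such that `V τ` refines `V σ`
whenever `σ < τ`. -/
def HasWellOrderedClopenPartitionBase (X : Type u) [TopologicalSpace X] : Prop :=
  ∃ (α : Ordinal.{u}) (V : Ordinal.{u} → Set (Set X)),
    (∀ τ < α, Setoid.IsPartition (V τ) ∧ ∀ U ∈ V τ, IsClopen U) ∧
    (∀ σ τ : Ordinal.{u}, σ < τ → τ < α → FamilyRefines (V τ) (V σ)) ∧
    TopologicalSpace.IsTopologicalBasis (⋃ τ < α, V τ)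

/-!
1 ⇒ 3. If `0` has a countable neighborhood base, the left uniformity makes `G` metrizable. A totally
disconnected ordered space has clopen sets between closed sets and their open neighborhoods, so by
paracompactness every open cover is refined by a clopen partition; apply this to the covers by balls
of radius `1 / n`. Otherwise take a family of `κ` neighborhoods of `0` with `κ` least such that the
intersection is not a neighborhood. Each contains a countable intersection of order-convex
neighborhoods that is an invariant subgyrogroup. The intersection of all these is again one, and is
trivial: an order-convex subgyrogroup without interior contains only `0` and possibly immediate
neighbors of `0`, which can be avoided. Hence the chosen neighborhoods generate `𝓝 0`, so `κ` is
uncountable. Well-order the subgyrogroups in type `κ`; the left cosets of the intersections of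
initial segments are the partitions sought.

3 ⇒ 2. Assigning to a point the least `τ` at which its class lies in a member of a given open cover
yields a partition refining the cover. For orderability, if no point has a compact neighborhood,
label the classes recursively so that no class has a least or a greatest label among its
subclasses, and compare points lexicographically. If some point has one, homogeneity gives a
partition into compact clopen sets; order these so that every non-extremal one has both neighbors,
and the points inside each lexicographically.

2 ⇒ 1. A clopen partition refining the cover by `{f ≠ 0}` and `{f ≠ 1}` separates two points at
which `f` takes the values `0` and `1`.
-/

universe v w

namespace Gyrogroup

section Algebra

variable {G : Type u} [Gyrogroup G]

lemma add_right_injective (a : G) : Function.Injective (a + ·) := by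
  intro b c h
  have h' : -a + (a + b) = -a + (a + c) := congrArg (-a + ·) h
  rw [gyr_assoc, gyr_assoc, neg_add', zero_add', zero_add'] at h'
  exact (gyr (-a) a).injective h'

lemma gyr_zero_left (a b : G) : gyr 0 a b = b := by
  have h := gyr_assoc 0 a b
  rw [zero_add', zero_add'] at h
  exact (add_right_injective a h).symm

lemma neg_add_add (a b : G) : -a + (a + b) = b := by
  rw [gyr_assoc, gyr_loop, neg_add', zero_add', gyr_zero_left]

lemma add_neg_add (a b : G) : a + (-a + b) = b := by
  rw [gyr_assoc, gyr_loop, add_neg', zero_add', gyr_zero_left]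

lemma neg_add_eq_add_gyr (x y z : G) : -x + z = (-x + y) + gyr (-x) y (-y + z) := by
  rw [← gyr_assoc, add_neg_add]

lemma gyr_neg_add (x y : G) : gyr (-x) y (-y + x) = -(-x + y) := by
  have h := neg_add_eq_add_gyr x y x
  rw [neg_add', ← add_neg' (-x + y)] at h
  exact (add_right_injective _ h).symm

lemma neg_zero' : -(0 : G) = 0 := by
  rw [← add_zero' (-(0 : G)), neg_add']

lemma neg_neg' (a : G) : -(-a) = a :=
  add_right_injective (-a) (by simp only [add_neg', neg_add'])

lemma neg_add_eq_neg_gyr (x y : G) : -y + x = -gyr (-y) x (-x + y) := by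
  rw [gyr_neg_add, neg_neg']

/-- The gyrogroup operation, the inversion and all gyrations map `W` into `U`. -/
structure OperationsMapInto (W U : Set G) : Prop where
  add_mem : ∀ {x y}, x ∈ W → y ∈ W → x + y ∈ U
  neg_mem : ∀ {x}, x ∈ W → -x ∈ U
  gyr_mem : ∀ a b {x}, x ∈ W → gyr a b x ∈ U

/-- A subgyrogroup that is invariant under all gyrations; its left cosets partition the
gyrogroup. -/
structure IsInvariantSubgyrogroup (H : Set G) : Prop extends OperationsMapInto H H where
  zero_mem : (0 : G) ∈ H

namespace OperationsMapInto

lemma mono {W W' U U' : Set G} (h : OperationsMapInto W U) (hW : W' ⊆ W) (hU : U ⊆ U') :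
    OperationsMapInto W' U' where
  add_mem hx hy := hU (h.add_mem (hW hx) (hW hy))
  neg_mem hx := hU (h.neg_mem (hW hx))
  gyr_mem a b _ hx := hU (h.gyr_mem a b (hW hx))

lemma subset {W U : Set G} (h : OperationsMapInto W U) : W ⊆ U := fun x hx => by
  rw [← gyr_zero_left 0 x]
  exact h.gyr_mem 0 0 hx

lemma iInter {ι : Sort v} {W : Set G} {U : ι → Set G} (h : ∀ i, OperationsMapInto W (U i)) :
    OperationsMapInto W (⋂ i, U i) where
  add_mem hx hy := mem_iInter.2 fun i => (h i).add_mem hx hy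
  neg_mem hx := mem_iInter.2 fun i => (h i).neg_mem hx
  gyr_mem a b _ hx := mem_iInter.2 fun i => (h i).gyr_mem a b hx

end OperationsMapInto

namespace IsInvariantSubgyrogroup

lemma iInter {ι : Sort v} {H : ι → Set G} (h : ∀ i, IsInvariantSubgyrogroup (H i)) :
    IsInvariantSubgyrogroup (⋂ i, H i) where
  toOperationsMapInto := .iInter fun i =>
    (h i).toOperationsMapInto.mono (iInter_subset H i) Subset.rfl
  zero_mem := mem_iInter.2 fun i => (h i).zero_mem

lemma iInter_of_operationsMapInto_succ {O : ℕ → Set G} (h0 : ∀ n, (0 : G) ∈ O n)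
    (h : ∀ n, OperationsMapInto (O (n + 1)) (O n)) : IsInvariantSubgyrogroup (⋂ n, O n) where
  toOperationsMapInto := .iInter fun n => (h n).mono (iInter_subset O (n + 1)) Subset.rfl
  zero_mem := mem_iInter.2 h0

/-- The partition of a gyrogroup into the left cosets `x + H` of an invariant subgyrogroup `H`. -/
def leftCosetSetoid {H : Set G} (hH : IsInvariantSubgyrogroup H) : Setoid G where
  r x y := -y + x ∈ H
  iseqv :=
    { refl x := by
        rw [neg_add']
        exact hH.zero_mem
      symm {x y} h := by
        rw [neg_add_eq_neg_gyr]
        exact hH.neg_mem (hH.gyr_mem _ _ h)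
      trans {x y z} hxy hyz := by
        rw [neg_add_eq_add_gyr z y x]
        exact hH.add_mem hyz (hH.gyr_mem _ _ hxy) }

end IsInvariantSubgyrogroup

end Algebra

section Topology

variable {G : Type u} [Gyrogroup G] [TopologicalSpace G]

/-- Left translation as a homeomorphism. -/
def leftHomeomorph [ContinuousAdd G] (a : G) : G ≃ₜ G where
  toFun x := a + x
  invFun x := -a + x
  left_inv := neg_add_add a
  right_inv := add_neg_add a

@[simp] lemma leftHomeomorph_apply [ContinuousAdd G] (a x : G) :
    leftHomeomorph a x = a + x := rfl

lemma nhds_eq_comap [ContinuousAdd G] (a : G) :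
    𝓝 a = Filter.comap (fun x => -a + x) (𝓝 0) := by
  have h := (leftHomeomorph (-a)).isInducing.nhds_eq_comap a
  rwa [leftHomeomorph_apply, neg_add'] at h

lemma IsInvariantSubgyrogroup.mem_nhds_zero [ContinuousAdd G] {H : Set G}
    (hH : IsInvariantSubgyrogroup H) {a : G} (ha : a ∈ H) (h : H ∈ 𝓝 a) : H ∈ 𝓝 (0 : G) := by
  have htend : Filter.Tendsto (leftHomeomorph a) (𝓝 0) (𝓝 a) := by
    simpa only [leftHomeomorph_apply, add_zero'] using (leftHomeomorph a).continuous.tendsto 0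
  filter_upwards [htend h] with x hx
  rw [← neg_add_add a x]
  exact hH.add_mem (hH.neg_mem ha) hx

variable [IsStronglyTopologicalGyrogroup G]

lemma exists_operationsMapInto {U : Set G} (hU : U ∈ 𝓝 (0 : G)) :
    ∃ W ∈ 𝓝 (0 : G), OperationsMapInto W U := by
  obtain ⟨𝒰, hb, hinv⟩ :=
    IsStronglyTopologicalGyrogroup.exists_gyr_invariant_basis (G := G)
  have hadd : Filter.Tendsto (fun p : G × G => p.1 + p.2) (𝓝 0 ×ˢ 𝓝 0) (𝓝 (0 : G)) := by
    have : Continuous (fun p : G × G => p.1 + p.2) := by fun_prop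
    simpa only [nhds_prod_eq, add_zero'] using this.tendsto (0, 0)
  have hneg : Filter.Tendsto (fun p : G => -p) (𝓝 0) (𝓝 (0 : G)) := by
    simpa only [neg_zero'] using (continuous_neg (G := G)).tendsto 0
  obtain ⟨A, hA, hAU⟩ := Filter.mem_prod_same_iff.1 (hadd hU)
  obtain ⟨W, hW, hWA⟩ := hb.mem_iff.1 (Filter.inter_mem (Filter.inter_mem hA hU) (hneg hU))
  refine ⟨W, hb.mem_of_mem hW, fun hx hy => ?_, fun hx => (hWA hx).2, fun a b x hx => ?_⟩
  · exact hAU (mk_mem_prod (hWA hx).1.1 (hWA hy).1.1)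
  · have hgyr : gyr a b x ∈ W := hinv W hW a b ▸ mem_image_of_mem _ hx
    exact (hWA hgyr).1.2

variable (G) in
/-- The left uniformity of a strongly topological gyrogroup: `x` and `y` are close if `-x + y` is
close to `0`. -/
abbrev leftUniformSpace : UniformSpace G where
  uniformity := Filter.comap (fun p : G × G => -p.1 + p.2) (𝓝 0)
  symm := by
    rw [Filter.tendsto_comap_iff]
    intro U hU
    obtain ⟨V, hV, hVU⟩ := exists_operationsMapInto hU
    obtain ⟨W, hW, hWV⟩ := exists_operationsMapInto hV
    refine ⟨W, hW, fun p hp => ?_⟩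
    change -p.2 + p.1 ∈ U
    rw [neg_add_eq_neg_gyr]
    exact hVU.neg_mem (hWV.gyr_mem _ _ hp)
  comp := by
    rintro S ⟨U, hU, hUS⟩
    obtain ⟨V, hV, hVU⟩ := exists_operationsMapInto hU
    obtain ⟨W, hW, hWV⟩ := exists_operationsMapInto hV
    refine Filter.mem_lift'_sets (fun s t hst => SetRel.comp_subset_comp hst hst) |>.2
      ⟨_, ⟨W, hW, Subset.rfl⟩, ?_⟩
    rintro ⟨x, z⟩ ⟨y, hxy, hyz⟩
    apply hUS
    change -x + z ∈ U
    rw [neg_add_eq_add_gyr x y z]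
    exact hVU.add_mem (hWV.subset hxy) (hWV.gyr_mem _ _ hyz)
  nhds_eq_comap_uniformity x := by
    rw [nhds_eq_comap, Filter.comap_comap]
    rfl

lemma pseudoMetrizableSpace_of_isCountablyGenerated [(𝓝 (0 : G)).IsCountablyGenerated] :
    TopologicalSpace.PseudoMetrizableSpace G :=
  letI := leftUniformSpace G
  haveI : (uniformity G).IsCountablyGenerated := Filter.comap.isCountablyGenerated _ _
  UniformSpace.pseudoMetrizableSpace

end Topology

end Gyrogroup

/-- Every open cover has a refinement by a partition into open sets; it consists of the fibers of a
locally constant map that assigns to each point a member of the cover containing it. -/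
def IsUltraparacompact (X : Type u) [TopologicalSpace X] : Prop :=
  ∀ 𝒰 : Set (Set X), (∀ U ∈ 𝒰, IsOpen U) → ⋃₀ 𝒰 = univ →
    ∃ c : X → Set X, IsLocallyConstant c ∧ ∀ x, c x ∈ 𝒰 ∧ x ∈ c x

section PartitionBase

variable {X : Type u} [TopologicalSpace X]

/-- The partitions of `X` into the classes of the relations `r i` get finer as `i` grows and
together form a base of the topology. -/
structure IsPartitionBase {ι : Type v} [Preorder ι] (r : ι → Setoid X) : Prop where
  antitone : Antitone r
  hasBasis : ∀ x, (𝓝 x).HasBasis (fun _ => True) fun i => {y | r i y x}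

lemma setoid_class_eq {X : Type u} {s : Setoid X} {x y : X} (hyx : s y x) :
    {z | s z y} = {z | s z x} :=
  Set.ext fun _ => ⟨fun hz => s.trans hz hyx, fun hz => s.trans hz (s.symm hyx)⟩

lemma isClopen_setoid_class {s : Setoid X} (h : ∀ x, {y | s y x} ∈ 𝓝 x) (x : X) :
    IsClopen {y | s y x} := by
  have hopen (x : X) : IsOpen {y | s y x} := isOpen_iff_mem_nhds.2 fun y hy =>
    Filter.mem_of_superset (h y) fun z hz => s.trans hz hy
  refine ⟨isOpen_compl_iff.1 (isOpen_iff_mem_nhds.2 fun y hy => ?_), hopen x⟩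
  filter_upwards [h y] with z hz hzx
  exact hy (s.trans (s.symm hz) hzx)

namespace IsPartitionBase

section Preorder

variable {ι : Type v} [Preorder ι] {r : ι → Setoid X}

lemma class_mem_nhds (h : IsPartitionBase r) (i : ι) (x : X) : {y | r i y x} ∈ 𝓝 x :=
  (h.hasBasis x).mem_of_mem trivial

lemma isClopen (h : IsPartitionBase r) (i : ι) (x : X) : IsClopen {y | r i y x} :=
  isClopen_setoid_class (h.class_mem_nhds i) x

lemma comp (h : IsPartitionBase r) {κ : Type w} [Preorder κ] {g : κ → ι} (hg : Monotone g)
    (hcof : ∀ i, ∃ k, i ≤ g k) : IsPartitionBase fun k => r (g k) where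
  antitone _ _ hkl := h.antitone (hg hkl)
  hasBasis x := (h.hasBasis x).to_hasBasis
    (fun i _ => (hcof i).imp fun _ hk => ⟨trivial, fun _ hy => h.antitone hk hy⟩)
    fun k _ => ⟨g k, trivial, Subset.rfl⟩

lemma exists_not_rel [T0Space X] (h : IsPartitionBase r) {x y : X} (hxy : x ≠ y) :
    ∃ i, ¬ r i y x := by
  by_contra! hall
  refine hxy (inseparable_iff_forall_isOpen.2 fun U hU => ⟨fun hx => ?_, fun hy => ?_⟩).eq
  · obtain ⟨i, -, hi⟩ := (h.hasBasis x).mem_iff.1 (hU.mem_nhds hx)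
    exact hi (hall i)
  · obtain ⟨i, -, hi⟩ := (h.hasBasis y).mem_iff.1 (hU.mem_nhds hy)
    exact hi ((r i).symm (hall i))

end Preorder

/-- The least index at which the class of a point is contained in a member of the cover is constant
on that class, so these classes form a partition. -/
lemma isUltraparacompact {ι : Type v} [LinearOrder ι] [WellFoundedLT ι] {r : ι → Setoid X}
    (h : IsPartitionBase r) : IsUltraparacompact X := by
  intro 𝒰 hopen hcover
  have hex (x : X) : {i | ∃ U ∈ 𝒰, {y | r i y x} ⊆ U}.Nonempty := by
    obtain ⟨U, hU, hxU⟩ := mem_sUnion.1 (hcover ▸ mem_univ x)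
    obtain ⟨i, -, hi⟩ := (h.hasBasis x).mem_iff.1 ((hopen U hU).mem_nhds hxU)
    exact ⟨i, U, hU, hi⟩
  let t (x : X) : ι := wellFounded_lt.min _ (hex x)
  let C (x : X) : Set X := {y | r (t x) y x}
  have ht (x : X) : ∃ U ∈ 𝒰, C x ⊆ U := wellFounded_lt.min_mem _ (hex x)
  have ht_le {x y : X} (hxy : r (t x) y x) : t y ≤ t x :=
    wellFounded_lt.min_le (by simpa only [Set.mem_ofPred_eq, setoid_class_eq hxy] using ht x)
  have hC {x y : X} (hxy : r (t x) y x) : C y = C x := by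
    have hyx : r (t y) x y := (r _).symm (h.antitone (ht_le hxy) hxy)
    have ht_eq : t y = t x := (ht_le hxy).antisymm (ht_le hyx)
    change {z | r (t y) z y} = _
    rw [ht_eq]
    exact setoid_class_eq hxy
  have hmem (x : X) : x ∈ C x := (r _).refl x
  choose! U hU hCU using fun c (hc : c ∈ range C) =>
    show ∃ U ∈ 𝒰, c ⊆ U by obtain ⟨x, rfl⟩ := hc; exact ht x
  refine ⟨fun x => U (C x), ?_, fun x => ⟨hU _ ⟨x, rfl⟩, hCU _ ⟨x, rfl⟩ (hmem x)⟩⟩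
  refine (IsLocallyConstant.iff_eventually_eq _).2 fun x => ?_
  filter_upwards [h.class_mem_nhds (t x) x] with y hy
  rw [hC hy]

end IsPartitionBase

lemma HasWellOrderedClopenPartitionBase.exists_isPartitionBase
    (h : HasWellOrderedClopenPartitionBase X) :
    ∃ (α : Ordinal.{u}) (r : Iio α → Setoid X), IsPartitionBase r := by
  obtain ⟨α, V, hV, href, hbase⟩ := h
  let r (τ : Iio α) : Setoid X := Setoid.mkClasses (V τ) (hV τ τ.2).1.2
  have hr (τ : Iio α) (x : X) : {y | r τ y x} ∈ V τ ∧ x ∈ {y | r τ y x} := by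
    refine ⟨?_, (r τ).refl x⟩
    have hx := (r τ).mem_classes x
    rwa [Setoid.classes_mkClasses _ (hV τ τ.2).1] at hx
  have eq_class {τ : Iio α} {U : Set X} (hU : U ∈ V τ) {x : X} (hx : x ∈ U) :
      U = {y | r τ y x} :=
    ((hV τ τ.2).1.2 x).unique ⟨hU, hx⟩ (hr τ x)
  refine ⟨α, r, fun σ τ hστ => ?_, fun x => ⟨fun U => ?_⟩⟩
  · rcases hστ.eq_or_lt with rfl | hlt
    · exact le_rfl
    intro x y hxy
    obtain ⟨W, hW, hsub⟩ := href σ τ hlt τ.2 _ (hr τ y).1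
    rw [eq_class hW (hsub (hr τ y).2)] at hsub
    exact hsub hxy
  · rw [hbase.mem_nhds_iff]
    simp only [mem_iUnion, exists_prop, true_and]
    constructor
    · rintro ⟨W, ⟨τ, hτ, hW⟩, hx, hWU⟩
      exact ⟨⟨τ, hτ⟩, (eq_class (τ := ⟨τ, hτ⟩) hW hx) ▸ hWU⟩
    · rintro ⟨τ, hτ⟩
      exact ⟨_, ⟨τ, τ.2, (hr τ x).1⟩, (hr τ x).2, hτ⟩

lemma IsPartitionBase.hasWellOrderedClopenPartitionBase {ι : Type u} [LinearOrder ι]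
    [WellFoundedLT ι] {r : ι → Setoid X} (h : IsPartitionBase r) :
    HasWellOrderedClopenPartitionBase X := by
  let rank (i : ι) : Ordinal.{u} := Ordinal.typein (α := ι) (· < ·) i
  let V (τ : Ordinal.{u}) : Set (Set X) := {c | ∃ i, rank i = τ ∧ c ∈ (r i).classes}
  have hV (i : ι) : V (rank i) = (r i).classes := by
    ext c
    simp only [V, rank, Ordinal.typein_inj, exists_eq_left, Set.mem_ofPred_eq]
  have hclopen (i : ι) : ∀ c ∈ (r i).classes, IsClopen c := by
    rintro _ ⟨x, rfl⟩
    exact h.isClopen i x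
  refine ⟨Ordinal.type (α := ι) (· < ·), V, fun τ hτ => ?_, fun σ τ hστ hτ => ?_, ?_⟩
  · obtain ⟨i, rfl⟩ := Ordinal.typein_surj _ hτ
    exact hV i ▸ ⟨(r i).isPartition_classes, hclopen i⟩
  · obtain ⟨i, rfl⟩ := Ordinal.typein_surj _ hτ
    obtain ⟨j, rfl⟩ := Ordinal.typein_surj _ (hστ.trans hτ)
    have hji : j < i := (Ordinal.typein_lt_typein _).1 hστ
    rintro _ ⟨_, hk, x, rfl⟩
    obtain rfl := Ordinal.typein_injective _ hk
    exact ⟨_, ⟨j, rfl, x, rfl⟩, fun y hy => h.antitone hji.le hy⟩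
  · refine TopologicalSpace.isTopologicalBasis_of_isOpen_of_nhds ?_ fun x U hx hU => ?_
    · simp only [mem_iUnion]
      rintro c ⟨_, _, i, -, hc⟩
      exact (hclopen i c hc).isOpen
    · obtain ⟨i, -, hi⟩ := (h.hasBasis x).mem_iff.1 (hU.mem_nhds hx)
      exact ⟨_, mem_iUnion₂.2 ⟨rank i, Ordinal.typein_lt_type _ i, i, rfl, x, rfl⟩,
        (r i).refl x, hi⟩

end PartitionBase

section CoveringDimension

variable {X : Type u} [TopologicalSpace X]

lemma isFunctionallyOpen_of_isClopen {U : Set X} (hU : IsClopen U) : IsFunctionallyOpen U := by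
  classical
  refine ⟨U.indicator 1, continuous_const.indicator (by simp [hU.frontier_eq]), ?_⟩
  ext x
  by_cases hx : x ∈ U <;> simp [hx]

lemma IsFunctionallyOpen.isOpen {U : Set X} (hU : IsFunctionallyOpen U) : IsOpen U := by
  obtain ⟨f, hf, rfl⟩ := hU
  exact isOpen_ne_fun hf continuous_const

lemma IsUltraparacompact.coveringDimLE_zero (h : IsUltraparacompact X) : CoveringDimLE X 0 := by
  intro 𝒰 h𝒰
  obtain ⟨c, hc, hmem⟩ := h 𝒰 (fun U hU => (h𝒰.functionallyOpen U hU).isOpen) h𝒰.cover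
  refine ⟨(fun U => c ⁻¹' {U}) '' 𝒰, ⟨h𝒰.finite.image _, ?_, ?_⟩, ?_, fun x => ?_⟩
  · rintro _ ⟨U, -, rfl⟩
    exact isFunctionallyOpen_of_isClopen (hc.isClopen_fiber U)
  · exact eq_univ_of_forall fun x => ⟨_, ⟨c x, (hmem x).1, rfl⟩, rfl⟩
  · rintro _ ⟨U, hU, rfl⟩
    exact ⟨U, hU, fun x hx => (mem_singleton_iff.1 hx) ▸ (hmem x).2⟩
  · simp only [Nat.cast_zero, zero_add, Set.encard_le_one_iff]
    rintro _ _ ⟨⟨U, -, rfl⟩, rfl⟩ ⟨⟨U', -, rfl⟩, rfl⟩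
    rfl

lemma isClopen_of_mem_of_encard_le_one {𝒱 : Set (Set X)} (hopen : ∀ V ∈ 𝒱, IsOpen V)
    (hcover : ⋃₀ 𝒱 = univ) (h : ∀ x, {V ∈ 𝒱 | x ∈ V}.encard ≤ 1) {V : Set X} (hV : V ∈ 𝒱) :
    IsClopen V := by
  refine ⟨isOpen_compl_iff.1 (isOpen_iff_mem_nhds.2 fun x hx => ?_), hopen V hV⟩
  obtain ⟨W, hW, hxW⟩ := mem_sUnion.1 (hcover ▸ mem_univ x)
  filter_upwards [(hopen W hW).mem_nhds hxW] with y hyW hyV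
  have hVW : V = W := Set.encard_le_one_iff.1 (h y) V W ⟨hV, hyV⟩ ⟨hW, hyW⟩
  exact hx (hVW ▸ hxW)

lemma CoveringDimLE.totallySeparatedSpace [T35Space X] (h : CoveringDimLE X 0) :
    TotallySeparatedSpace X := by
  refine totallySeparatedSpace_iff_exists_isClopen.2 fun x y hxy => ?_
  obtain ⟨f, hf, hfx, hfy⟩ := CompletelyRegularSpace.completely_regular x {y} isClosed_singleton hxy
  replace hfy : f y = 1 := hfy rfl
  have hcover : IsFiniteFunctionallyOpenCover {{z | (f z : ℝ) ≠ 0}, {z | (f z : ℝ) - 1 ≠ 0}} := by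
    refine ⟨by simp, ?_, eq_univ_of_forall fun z => ?_⟩
    · rintro U (rfl | rfl)
      · exact ⟨fun z => f z, by fun_prop, rfl⟩
      · exact ⟨fun z => f z - 1, by fun_prop, rfl⟩
    · by_cases hz : (f z : ℝ) = 0
      · exact ⟨_, Or.inr rfl, by simp [hz]⟩
      · exact ⟨_, Or.inl rfl, hz⟩
  obtain ⟨𝒱, h𝒱, href, hord⟩ := h _ hcover
  obtain ⟨V, hV, hxV⟩ := mem_sUnion.1 (h𝒱.cover ▸ mem_univ x)
  refine ⟨V, isClopen_of_mem_of_encard_le_one (fun W hW => (h𝒱.functionallyOpen W hW).isOpen)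
    h𝒱.cover (by simpa using hord) hV, hxV, fun hyV => ?_⟩
  obtain ⟨W, rfl | rfl, hVW⟩ := href V hV
  · exact hVW hxV (by simp [hfx])
  · exact hVW hyV (by simp [hfy])

lemma coveringDim_eq_zero_iff [Nonempty X] : coveringDim X = 0 ↔ CoveringDimLE X 0 := by
  rw [coveringDim, if_neg (not_isEmpty_of_nonempty X), ← WithBot.coe_zero, WithBot.coe_inj,
    ENat.iInf_eq_zero]
  constructor
  · rintro ⟨⟨n, hn⟩, h⟩
    obtain rfl : n = 0 := Nat.cast_eq_zero.1 h
    exact hn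
  · exact fun h => ⟨⟨0, h⟩, Nat.cast_zero⟩

end CoveringDimension

section Ultraparacompact

variable {X : Type u}

/-- Two points are related at `i` if their labels below `i` agree. -/
def agreeBelow {ι : Type v} {M : Type w} [LT ι] (f : X → ι → M) (i : ι) : Setoid X where
  r y x := ∀ j < i, f y j = f x j
  iseqv :=
    { refl _ _ _ := rfl
      symm h j hj := (h j hj).symm
      trans h h' j hj := (h j hj).trans (h' j hj) }

lemma antitone_agreeBelow {ι : Type v} {M : Type w} [Preorder ι] (f : X → ι → M) :
    Antitone (agreeBelow f) :=
  fun _ _ hij _ _ h k hk => h k (hk.trans_le hij)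

variable [TopologicalSpace X]

lemma exists_isLocallyConstant_mem_of_locallyFinite {ι : Type v} {D : ι → Set X}
    (hD : LocallyFinite D) (hclopen : ∀ i, IsClopen (D i)) (hcover : ⋃ i, D i = univ) :
    ∃ c : X → ι, IsLocallyConstant c ∧ ∀ x, x ∈ D (c x) := by
  obtain ⟨_, _⟩ := exists_wellFoundedLT ι
  have hex (x : X) : {i | x ∈ D i}.Nonempty := mem_iUnion.1 (hcover ▸ mem_univ x)
  let c (x : X) : ι := wellFounded_lt.min {i | x ∈ D i} (hex x)
  have hc (x : X) : x ∈ D (c x) := wellFounded_lt.min_mem {i | x ∈ D i} (hex x)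
  have hmin {x : X} {i : ι} (hi : x ∈ D i) : c x ≤ i :=
    wellFounded_lt.min_le (s := {i | x ∈ D i}) hi
  refine ⟨c, (IsLocallyConstant.iff_eventually_eq c).2 fun x => ?_, hc⟩
  have hopen : IsOpen (⋃ j : Iio (c x), D j)ᶜ :=
    ((hD.comp_injective Subtype.val_injective).isClosed_iUnion
      fun j => (hclopen j.1).isClosed).isOpen_compl
  have hx : x ∈ (⋃ j : Iio (c x), D j)ᶜ := fun h => by
    obtain ⟨⟨j, hj⟩, hxj⟩ := mem_iUnion.1 h
    exact (hmin hxj).not_gt hj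
  filter_upwards [(hclopen (c x)).isOpen.mem_nhds (hc x), hopen.mem_nhds hx] with y hy hy'
  exact (hmin hy).antisymm (not_lt.1 fun hlt => hy' (mem_iUnion.2 ⟨⟨c y, hlt⟩, hc y⟩))

lemma isUltraparacompact_of_exists_isClopen_between [ParacompactSpace X] [NormalSpace X]
    (h : ∀ A U : Set X, IsClosed A → IsOpen U → A ⊆ U → ∃ C, IsClopen C ∧ A ⊆ C ∧ C ⊆ U) :
    IsUltraparacompact X := by
  intro 𝒰 hopen hcov
  obtain ⟨V, hVo, hVcov, hVfin, hVU⟩ := precise_refinement (fun U : 𝒰 => (U : Set X))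
    (fun U => hopen U U.2) (by rw [← sUnion_eq_iUnion, hcov])
  obtain ⟨W, hWcov, -, hWV⟩ := exists_subset_iUnion_closure_subset isClosed_univ hVo
    (fun x _ => hVfin.point_finite x) hVcov.ge
  choose D hDc hWD hDV using fun i => h (closure (W i)) (V i) isClosed_closure (hVo i) (hWV i)
  have hDcov : ⋃ i, D i = univ :=
    univ_subset_iff.1 (hWcov.trans (iUnion_mono fun i => subset_closure.trans (hWD i)))
  obtain ⟨c, hc, hcD⟩ := exists_isLocallyConstant_mem_of_locallyFinite (hVfin.subset hDV) hDc hDcov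
  exact ⟨fun x => c x, hc.comp _, fun x => ⟨(c x).2, hVU _ (hDV _ (hcD x))⟩⟩

lemma IsUltraparacompact.exists_isLocallyConstant_dist_lt {X : Type u} [PseudoMetricSpace X]
    (h : IsUltraparacompact X) {ε : ℝ} (hε : 0 < ε) :
    ∃ c : X → Set X, IsLocallyConstant c ∧ ∀ x y, c y = c x → dist y x < ε := by
  obtain ⟨c, hc, hmem⟩ := h (range fun x => Metric.ball x (ε / 2))
    (by rintro _ ⟨x, rfl⟩; exact Metric.isOpen_ball)
    (eq_univ_of_forall fun x => ⟨_, mem_range_self x, Metric.mem_ball_self (half_pos hε)⟩)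
  refine ⟨c, hc, fun x y hxy => ?_⟩
  obtain ⟨⟨z, hz⟩, hx⟩ := hmem x
  have hy := hxy ▸ (hmem y).2
  rw [← hz] at hx hy
  linarith [dist_triangle_right y x z, Metric.mem_ball.1 hx, Metric.mem_ball.1 hy]

lemma IsUltraparacompact.hasWellOrderedClopenPartitionBase
    [TopologicalSpace.PseudoMetrizableSpace X] (h : IsUltraparacompact X) :
    HasWellOrderedClopenPartitionBase X := by
  let _ := TopologicalSpace.pseudoMetrizableSpacePseudoMetric X
  choose c hc hdist using fun n : ℕ =>
    h.exists_isLocallyConstant_dist_lt (Nat.one_div_pos_of_nat (n := n) (α := ℝ))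
  have hbase : IsPartitionBase (agreeBelow fun x n => c n x) := by
    refine ⟨antitone_agreeBelow _, fun x => ⟨fun U => ⟨fun hU => ?_, ?_⟩⟩⟩
    · obtain ⟨ε, hε, hball⟩ := Metric.mem_nhds_iff.1 hU
      obtain ⟨n, hn⟩ := exists_nat_one_div_lt hε
      exact ⟨n + 1, trivial, fun y hy =>
        hball ((hdist n x y (hy n n.lt_succ_self)).trans hn)⟩
    · rintro ⟨n, -, hn⟩
      refine Filter.mem_of_superset ((Filter.biInter_mem (finite_Iio n)).2 fun k _ =>
        ((hc k).isOpen_fiber (c k x)).mem_nhds rfl) fun y hy => hn fun k hk => ?_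
      exact mem_iInter₂.1 hy k hk
  exact (hbase.comp (g := ULift.down.{u}) (fun _ _ h => h)
    fun n => ⟨⟨n⟩, le_rfl⟩).hasWellOrderedClopenPartitionBase

end Ultraparacompact

section LinearOrder

variable {X : Type u} [LinearOrder X] [TopologicalSpace X] [OrderTopology X]

lemma exists_Iio_subset_of_Iic_subset {A : Set X} {x : X} (hx : Iic x ⊆ A) (hA : A ∈ 𝓝 x)
    (h : ∃ y, x < y) : ∃ u > x, Iio u ⊆ A := by
  obtain ⟨u, hxu, hu⟩ := exists_Ico_subset_of_mem_nhds hA h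
  exact ⟨u, hxu, fun z hz => (le_total z x).elim (fun hzx => hx hzx) fun hxz => hu ⟨hxz, hz⟩⟩

lemma isOpen_upperClosure {A : Set X} (hA : IsOpen A) : IsOpen (upperClosure A : Set X) := by
  refine isOpen_iff_mem_nhds.2 fun x ⟨a, ha, hax⟩ => ?_
  rcases hax.eq_or_lt with rfl | hlt
  · exact Filter.mem_of_superset (hA.mem_nhds ha) subset_upperClosure
  · filter_upwards [Ioi_mem_nhds hlt] with z hz using ⟨a, ha, le_of_lt hz⟩

lemma isClosed_upperClosure {A : Set X} (hA : IsClosed A) :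
    IsClosed (upperClosure A : Set X) := by
  refine isOpen_compl_iff.1 (isOpen_iff_mem_nhds.2 fun x hx => ?_)
  have hsub : Iic x ⊆ Aᶜ := fun y hyx hy => hx ⟨y, hy, hyx⟩
  by_cases hmax : ∃ y, x < y
  · obtain ⟨u, hxu, hu⟩ := exists_Iio_subset_of_Iic_subset hsub
      (hA.isOpen_compl.mem_nhds (hsub self_mem_Iic)) hmax
    filter_upwards [Iio_mem_nhds hxu] with z hz
    exact fun ⟨a, ha, haz⟩ => hu (haz.trans_lt hz) ha
  · push Not at hmax
    exact Filter.univ_mem' fun z ⟨a, ha, _⟩ => hsub (hmax a) ha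

lemma isOpen_lowerClosure {A : Set X} (hA : IsOpen A) : IsOpen (lowerClosure A : Set X) :=
  isOpen_upperClosure (X := Xᵒᵈ) hA

lemma isClosed_lowerClosure {A : Set X} (hA : IsClosed A) :
    IsClosed (lowerClosure A : Set X) :=
  isClosed_upperClosure (X := Xᵒᵈ) hA

lemma exists_isClopen_isLowerSet_of_not_preconnectedSpace [BoundedOrder X]
    (h : ¬ PreconnectedSpace X) :
    ∃ L : Set X, IsClopen L ∧ IsLowerSet L ∧ ⊥ ∈ L ∧ ⊤ ∉ L := by
  obtain ⟨C, hC, hbot, hne⟩ : ∃ C : Set X, IsClopen C ∧ ⊥ ∉ C ∧ C.Nonempty := by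
    simp only [preconnectedSpace_iff_clopen, not_forall, not_or] at h
    obtain ⟨C, hC, hne, hne'⟩ := h
    by_cases hbot : ⊥ ∈ C
    · exact ⟨Cᶜ, hC.compl, not_not.2 hbot, nonempty_compl.2 hne'⟩
    · exact ⟨C, hC, hbot, nonempty_iff_ne_empty.2 hne⟩
  refine ⟨(upperClosure C : Set X)ᶜ,
    IsClopen.compl ⟨isClosed_upperClosure hC.isClosed, isOpen_upperClosure hC.isOpen⟩,
    (upperClosure C).upper.compl, fun ⟨c, hc, hle⟩ => hbot (le_bot_iff.1 hle ▸ hc), ?_⟩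
  obtain ⟨c, hc⟩ := hne
  exact not_not.2 ⟨c, hc, le_top⟩

lemma exists_isClopen_isLowerSet_of_lt [TotallyDisconnectedSpace X] {w z : X} (hwz : w < z) :
    ∃ L : Set X, IsClopen L ∧ IsLowerSet L ∧ w ∈ L ∧ z ∉ L := by
  have : Fact (w ≤ z) := ⟨hwz.le⟩
  have hnot : ¬ PreconnectedSpace (Icc w z) := fun h =>
    hwz.ne ((isPreconnected_iff_preconnectedSpace.2 h).subsingleton (left_mem_Icc.2 hwz.le)
      (right_mem_Icc.2 hwz.le))
  obtain ⟨L, hL, hlower, hw, hz⟩ := exists_isClopen_isLowerSet_of_not_preconnectedSpace hnot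
  refine ⟨projIcc w z hwz.le ⁻¹' L, hL.preimage continuous_projIcc,
    hlower.preimage (monotone_projIcc hwz.le), ?_, ?_⟩
  · rwa [mem_preimage, projIcc_left]
  · rwa [mem_preimage, projIcc_right]

lemma exists_isGreatest_of_isLowerSet {S : Set X} (hS : IsLowerSet S) (h : ¬ IsOpen S) :
    ∃ m, IsGreatest S m := by
  contrapose! h
  refine isOpen_iff_mem_nhds.2 fun x hx => ?_
  have hx' : ¬ x ∈ upperBounds S := fun hub => h x ⟨hx, hub⟩
  simp only [mem_upperBounds, not_forall, not_le] at hx'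
  obtain ⟨y, hy, hxy⟩ := hx'
  filter_upwards [Iio_mem_nhds hxy] with z hz using hS (le_of_lt hz) hy

lemma exists_isLeast_of_isUpperSet {S : Set X} (hS : IsUpperSet S) (h : ¬ IsOpen S) :
    ∃ m, IsLeast S m :=
  exists_isGreatest_of_isLowerSet (X := Xᵒᵈ) hS.toDual h

lemma exists_isClopen_isLowerSet_between [TotallyDisconnectedSpace X] {P S : Set X}
    (hP : IsClosed P) (hPl : IsLowerSet P) (hS : IsOpen S) (hSl : IsLowerSet S) (hPS : P ⊆ S) :
    ∃ L : Set X, IsClopen L ∧ IsLowerSet L ∧ P ⊆ L ∧ L ⊆ S := by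
  by_cases hPo : IsOpen P
  · exact ⟨P, ⟨hP, hPo⟩, hPl, Subset.rfl, hPS⟩
  by_cases hSc : IsClosed S
  · exact ⟨S, ⟨hSc, hS⟩, hSl, hPS, Subset.rfl⟩
  obtain ⟨m, hm, hmax⟩ := exists_isGreatest_of_isLowerSet hPl hPo
  obtain ⟨n, hn, hmin⟩ := exists_isLeast_of_isUpperSet hSl.compl fun ho => hSc ⟨ho⟩
  have hmn : m < n := lt_of_not_ge fun h => hn (hSl h (hPS hm))
  obtain ⟨L, hL, hLl, hmL, hnL⟩ := exists_isClopen_isLowerSet_of_lt hmn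
  refine ⟨L, hL, hLl, fun x hx => hLl (hmax hx) hmL, fun x hx => ?_⟩
  by_contra hxS
  exact hnL (hLl (hmin hxS) hx)

lemma exists_isClopen_isUpperSet_between [TotallyDisconnectedSpace X] {P S : Set X}
    (hP : IsClosed P) (hPu : IsUpperSet P) (hS : IsOpen S) (hSu : IsUpperSet S) (hPS : P ⊆ S) :
    ∃ R : Set X, IsClopen R ∧ IsUpperSet R ∧ P ⊆ R ∧ R ⊆ S := by
  obtain ⟨L, hL, hLl, hSL, hLP⟩ := exists_isClopen_isLowerSet_between hS.isClosed_compl hSu.compl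
    hP.isOpen_compl hPu.compl (compl_subset_compl.2 hPS)
  exact ⟨Lᶜ, hL.compl, hLl.compl, subset_compl_comm.1 hLP, compl_subset_comm.1 hSL⟩

lemma exists_isClopen_between_of_ordConnected [TotallyDisconnectedSpace X] {B K : Set X}
    (hB : IsClosed B) (hK : IsOpen K) (hKc : K.OrdConnected) (hBK : B ⊆ K) :
    ∃ D, IsClopen D ∧ B ⊆ D ∧ D ⊆ K := by
  obtain ⟨L, hL, -, hBL, hLK⟩ := exists_isClopen_isLowerSet_between (isClosed_lowerClosure hB)
    (lowerClosure B).lower (isOpen_lowerClosure hK) (lowerClosure K).lower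
    (lowerClosure_mono hBK)
  obtain ⟨R, hR, -, hBR, hRK⟩ := exists_isClopen_isUpperSet_between (isClosed_upperClosure hB)
    (upperClosure B).upper (isOpen_upperClosure hK) (upperClosure K).upper
    (upperClosure_anti hBK)
  refine ⟨R ∩ L, hR.inter hL,
    subset_inter (subset_upperClosure.trans hBR) (subset_lowerClosure.trans hBL), ?_⟩
  rw [← hKc.upperClosure_inter_lowerClosure]
  exact inter_subset_inter hRK hLK

lemma isOpen_ordConnectedComponent {U : Set X} (hU : IsOpen U) (a : X) :
    IsOpen (ordConnectedComponent U a) := isOpen_iff_mem_nhds.2 fun x hx => by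
  rw [ordConnectedComponent_eq hx]
  exact ordConnectedComponent_mem_nhds.2 (hU.mem_nhds (ordConnectedComponent_subset hx))

lemma isClosed_inter_ordConnectedComponent {A U : Set X} (hA : IsClosed A) (hU : IsOpen U)
    (hAU : A ⊆ U) (a : X) : IsClosed (A ∩ ordConnectedComponent U a) := by
  refine isOpen_compl_iff.1 (isOpen_iff_mem_nhds.2 fun z hz => ?_)
  by_cases hzA : z ∈ A
  · filter_upwards [ordConnectedComponent_mem_nhds.2 (hU.mem_nhds (hAU hzA))] with y hzy hy
    exact hz ⟨hzA, mem_ordConnectedComponent_trans hy.2 (mem_ordConnectedComponent_comm.1 hzy)⟩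
  · filter_upwards [hA.isOpen_compl.mem_nhds hzA] with y hy using fun hy' => hy hy'.1

end LinearOrder

section OrdConnectedComponents

variable {X : Type u} [LinearOrder X]

/-- Both sets contain the smaller of the two points at which they enter `J`. -/
lemma inter_nonempty_of_lt {J K K' : Set X} [hJ : J.OrdConnected] [hKc : K.OrdConnected]
    [hKc' : K'.OrdConnected] {z : X} (hzJ : z ∈ J) (hzK : z ∉ K) (hzK' : z ∉ K')
    (hKJ : ∃ y ∈ K ∩ J, y < z) (hKJ' : ∃ y ∈ K' ∩ J, y < z) (hK : (K \ J).Nonempty)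
    (hK' : (K' \ J).Nonempty) : (K ∩ K').Nonempty := by
  have lt_of_mem {L : Set X} [hL : L.OrdConnected] (hzL : z ∉ L) {a x y : X} (ha : a ∈ L \ J)
      (hx : x ∈ L) (hxz : x < z) (hy : y ∈ J) : a < y := by
    by_contra! hya
    rcases le_total a z with haz | hza
    · exact ha.2 (hJ.out hy hzJ ⟨hya, haz⟩)
    · exact hzL (hL.out hx ha.1 ⟨hxz.le, hza⟩)
  obtain ⟨⟨y, hy, hyz⟩, y', hy', hyz'⟩ := hKJ, hKJ'
  obtain ⟨⟨a, ha⟩, a', ha'⟩ := hK, hK'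
  rcases le_total y y' with h | h
  · exact ⟨y, hy.1, hKc'.out ha'.1 hy'.1
      ⟨(lt_of_mem hzK' ha' hy'.1 hyz' hy.2).le, h⟩⟩
  · exact ⟨y', hKc.out ha.1 hy.1
      ⟨(lt_of_mem hzK ha hy.1 hyz hy'.2).le, h⟩, hy'.1⟩

lemma inter_nonempty_of_gt {J K K' : Set X} [hJ : J.OrdConnected] [hKc : K.OrdConnected]
    [hKc' : K'.OrdConnected] {z : X} (hzJ : z ∈ J) (hzK : z ∉ K) (hzK' : z ∉ K')
    (hKJ : ∃ y ∈ K ∩ J, z < y) (hKJ' : ∃ y ∈ K' ∩ J, z < y) (hK : (K \ J).Nonempty)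
    (hK' : (K' \ J).Nonempty) : (K ∩ K').Nonempty :=
  have := hJ.dual
  have := hKc.dual
  have := hKc'.dual
  inter_nonempty_of_lt (X := Xᵒᵈ) (J := OrderDual.ofDual ⁻¹' J) (K := OrderDual.ofDual ⁻¹' K)
    (K' := OrderDual.ofDual ⁻¹' K') hzJ hzK hzK' hKJ hKJ' hK hK'

lemma ordConnectedComponent_eq_of_inter_nonempty {U : Set X} {a b : X}
    (h : (ordConnectedComponent U a ∩ ordConnectedComponent U b).Nonempty) :
    ordConnectedComponent U a = ordConnectedComponent U b := by
  obtain ⟨c, hca, hcb⟩ := h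
  exact ordConnectedComponent_eq
    (mem_ordConnectedComponent_trans hca (mem_ordConnectedComponent_comm.1 hcb))

variable [TopologicalSpace X] [OrderTopology X]

lemma locallyFinite_ordConnectedComponent {A U : Set X} (hA : IsClosed A) (hU : IsOpen U)
    (hAU : A ⊆ U) :
    LocallyFinite fun K : (ordConnectedComponent U) '' A => (K : Set X) := by
  intro z
  by_cases hz : z ∈ U
  · refine ⟨ordConnectedComponent U z, ordConnectedComponent_mem_nhds.2 (hU.mem_nhds hz),
      Set.Subsingleton.finite ?_⟩
    rintro ⟨_, a, ha, rfl⟩ hK ⟨_, b, hb, rfl⟩ hK'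
    exact Subtype.ext ((ordConnectedComponent_eq_of_inter_nonempty hK).trans
      (ordConnectedComponent_eq_of_inter_nonempty hK').symm)
  let J := ordConnectedComponent Aᶜ z
  have hzA : z ∈ Aᶜ := fun h => hz (hAU h)
  have hzJ : z ∈ J := self_mem_ordConnectedComponent.2 hzA
  have hnot (K : (ordConnectedComponent U) '' A) : z ∉ (K : Set X) := by
    obtain ⟨_, a, ha, rfl⟩ := K
    exact fun h => hz (ordConnectedComponent_subset h)
  have hdiff {a : X} (ha : a ∈ A) : (ordConnectedComponent U a \ J).Nonempty :=
    ⟨a, self_mem_ordConnectedComponent.2 (hAU ha), fun h => ordConnectedComponent_subset h ha⟩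
  have hlt : {K : (ordConnectedComponent U) '' A | ∃ y ∈ (K : Set X) ∩ J, y < z}.Subsingleton := by
    rintro ⟨_, a, ha, rfl⟩ hK ⟨_, b, hb, rfl⟩ hK'
    exact Subtype.ext (ordConnectedComponent_eq_of_inter_nonempty
      (inter_nonempty_of_lt hzJ (hnot ⟨_, a, ha, rfl⟩) (hnot ⟨_, b, hb, rfl⟩) hK hK' (hdiff ha)
        (hdiff hb)))
  have hgt : {K : (ordConnectedComponent U) '' A | ∃ y ∈ (K : Set X) ∩ J, z < y}.Subsingleton := by
    rintro ⟨_, a, ha, rfl⟩ hK ⟨_, b, hb, rfl⟩ hK'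
    exact Subtype.ext (ordConnectedComponent_eq_of_inter_nonempty
      (inter_nonempty_of_gt hzJ (hnot ⟨_, a, ha, rfl⟩) (hnot ⟨_, b, hb, rfl⟩) hK hK' (hdiff ha)
        (hdiff hb)))
  refine ⟨J, ordConnectedComponent_mem_nhds.2 (hA.isOpen_compl.mem_nhds hzA),
    (hlt.finite.union hgt.finite).subset ?_⟩
  rintro K ⟨y, hy⟩
  exact (ne_of_mem_of_not_mem hy.1 (hnot K)).lt_or_gt.imp (fun h => ⟨y, hy, h⟩)
    fun h => ⟨y, hy, h⟩

lemma exists_isClopen_between [TotallyDisconnectedSpace X] {A U : Set X} (hA : IsClosed A)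
    (hU : IsOpen U) (hAU : A ⊆ U) : ∃ C, IsClopen C ∧ A ⊆ C ∧ C ⊆ U := by
  have hex (K : (ordConnectedComponent U) '' A) :
      ∃ D, IsClopen D ∧ A ∩ K ⊆ D ∧ D ⊆ (K : Set X) := by
    obtain ⟨_, a, -, rfl⟩ := K
    exact exists_isClopen_between_of_ordConnected
      (isClosed_inter_ordConnectedComponent hA hU hAU a) (isOpen_ordConnectedComponent hU a)
      inferInstance inter_subset_right
  choose D hD hAD hDK using hex
  refine ⟨⋃ K, D K, ⟨?_, isOpen_iUnion fun K => (hD K).isOpen⟩, fun a ha => ?_,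
    iUnion_subset fun K => (hDK K).trans ?_⟩
  · exact ((locallyFinite_ordConnectedComponent hA hU hAU).subset hDK).isClosed_iUnion
      fun K => (hD K).isClosed
  · exact mem_iUnion.2 ⟨⟨_, a, ha, rfl⟩, hAD _ ⟨ha, self_mem_ordConnectedComponent.2 (hAU ha)⟩⟩
  · obtain ⟨_, a, -, rfl⟩ := K
    exact ordConnectedComponent_subset

end OrdConnectedComponents

section LinearOrder

variable {X : Type u} [LinearOrder X] [TopologicalSpace X] [ClosedIicTopology X]
  [ClosedIciTopology X]

lemma orderTopology_of_exists_Ioc_Ico_subset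
    (hl : ∀ x : X, ∀ U ∈ 𝓝 x, (∃ l, l < x) → ∃ l < x, Ioc l x ⊆ U)
    (hr : ∀ x : X, ∀ U ∈ 𝓝 x, (∃ r, x < r) → ∃ r > x, Ico x r ⊆ U) : OrderTopology X := by
  have ht : @OrderTopology X (Preorder.topology X) _ := @OrderTopology.mk X (_) _ rfl
  refine ⟨TopologicalSpace.ext_nhds fun x => le_antisymm ?_ fun U hU => ?_⟩
  · rw [@nhds_eq_order X (Preorder.topology X) _ ht]
    exact le_inf (le_iInf₂ fun l hlx => Filter.le_principal_iff.2 (Ioi_mem_nhds hlx))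
      (le_iInf₂ fun r hxr => Filter.le_principal_iff.2 (Iio_mem_nhds hxr))
  · rw [← @nhdsLE_sup_nhdsGE X (Preorder.topology X) _ x]
    constructor
    · by_cases h : ∃ l, l < x
      · obtain ⟨l, hlx, hlU⟩ := hl x U hU h
        exact Filter.mem_of_superset (@Ioc_mem_nhdsLE X (Preorder.topology X) _ _ _ _ hlx) hlU
      · refine Filter.mem_of_superset (@self_mem_nhdsWithin X (Preorder.topology X) x _)
          fun y hy => ?_
        rw [(show y ≤ x from hy).eq_of_not_lt fun hlt => h ⟨y, hlt⟩]
        exact mem_of_mem_nhds hU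
    · by_cases h : ∃ r, x < r
      · obtain ⟨r, hxr, hrU⟩ := hr x U hU h
        exact Filter.mem_of_superset (@Ico_mem_nhdsGE X (Preorder.topology X) _ _ _ _ hxr) hrU
      · refine Filter.mem_of_superset (@self_mem_nhdsWithin X (Preorder.topology X) x _)
          fun y hy => ?_
        rw [← (show x ≤ y from hy).eq_of_not_lt fun hlt => h ⟨y, hlt⟩]
        exact mem_of_mem_nhds hU

section CompactFibers

variable {I : Type v} [LinearOrder I] {q : X → I}

lemma exists_Ioc_subset_of_isCompact_fiber (hq : Monotone q) (hsurj : q.Surjective)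
    (hcomp : ∀ i, IsCompact (q ⁻¹' {i})) (hpred : ∀ i : I, ¬ IsMin i → ∃ j, j ⋖ i) {x : X}
    {U : Set X} (hU : U ∈ 𝓝 x) (hx : ∃ l, l < x) : ∃ l < x, Ioc l x ⊆ U := by
  by_cases hfib : ∃ l < x, q l = q x
  · obtain ⟨l, hlx, hql⟩ := hfib
    let K := q ⁻¹' {q x} ∩ (Iic x ∩ (interior U)ᶜ)
    have hK : IsCompact (insert l K) := ((hcomp (q x)).inter_right
      (isClosed_Iic.inter isOpen_interior.isClosed_compl)).insert l
    obtain ⟨a, ha, hmax⟩ := hK.exists_isGreatest (insert_nonempty l K)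
    have hax : a < x ∧ q a = q x := by
      rcases ha with rfl | ⟨hqa, hax, haU⟩
      · exact ⟨hlx, hql⟩
      · refine ⟨lt_of_le_of_ne hax ?_, hqa⟩
        rintro rfl
        exact haU (mem_interior_iff_mem_nhds.2 hU)
    refine ⟨a, hax.1, fun y ⟨hay, hyx⟩ => ?_⟩
    by_contra hyU
    have hqy : q y = q x := (hq hyx).antisymm (hax.2 ▸ hq hay.le)
    exact (hmax (Or.inr ⟨hqy, hyx, fun h => hyU (interior_subset h)⟩)).not_gt hay
  · push Not at hfib
    obtain ⟨l, hlx⟩ := hx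
    have hql : q l < q x := lt_of_le_of_ne (hq hlx.le) (hfib l hlx)
    obtain ⟨j, hj⟩ := hpred (q x) (not_isMin_of_lt hql)
    obtain ⟨a, ha, hmax⟩ := (hcomp j).exists_isGreatest (hsurj j)
    obtain rfl : q a = j := ha
    refine ⟨a, hq.reflect_lt hj.lt, fun y ⟨hay, hyx⟩ => ?_⟩
    obtain rfl : y = x := by
      refine hyx.eq_of_not_lt fun hlt => ?_
      have hqy : q a < q y := lt_of_le_of_ne (hq hay.le) fun h => (hmax h.symm).not_gt hay
      exact hj.2 hqy (lt_of_le_of_ne (hq hyx) (hfib y hlt))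
    exact mem_of_mem_nhds hU

lemma exists_Ico_subset_of_isCompact_fiber (hq : Monotone q) (hsurj : q.Surjective)
    (hcomp : ∀ i, IsCompact (q ⁻¹' {i})) (hsucc : ∀ i : I, ¬ IsMax i → ∃ j, i ⋖ j) {x : X}
    {U : Set X} (hU : U ∈ 𝓝 x) (hx : ∃ r, x < r) : ∃ r > x, Ico x r ⊆ U := by
  obtain ⟨r, hxr, hr⟩ := exists_Ioc_subset_of_isCompact_fiber (X := Xᵒᵈ) (I := Iᵒᵈ) hq.dual hsurj
    hcomp (fun i hi => (hsucc i hi).imp fun _ hj => hj.toDual) hU hx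
  exact ⟨r, hxr, fun y hy => hr ⟨hy.2, hy.1⟩⟩

end CompactFibers

end LinearOrder

section DiscreteOrder

lemma nonempty_equiv_prod_int (S : Type u) [Infinite S] : Nonempty (S ≃ S × ℤ) := by
  rw [← Cardinal.lift_mk_eq', Cardinal.mk_prod]
  simp

lemma exists_injective_forall_exists_covBy (S : Type u) [Infinite S] :
    ∃ f : S → Ordinal.{u} ×ₗ ℤ, f.Injective ∧ ∀ s, (∃ t, f t ⋖ f s) ∧ ∃ t, f s ⋖ f t := by
  obtain ⟨e⟩ := nonempty_equiv_prod_int S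
  let g : S → Ordinal.{u} := Ordinal.typein WellOrderingRel
  have hg : g.Injective := Ordinal.typein_injective _
  refine ⟨fun s => toLex (g (e s).1, (e s).2), ?_, fun s =>
    ⟨⟨e.symm ((e s).1, (e s).2 - 1), ?_⟩, e.symm ((e s).1, (e s).2 + 1), ?_⟩⟩
  · exact toLex.injective.comp ((hg.prodMap Function.injective_id).comp e.injective)
  · simp [Prod.Lex.toLex_covBy_toLex_iff]
  · simp [Prod.Lex.toLex_covBy_toLex_iff]

lemma exists_linearOrder_forall_exists_covBy (I : Type u) :
    ∃ _ : LinearOrder I,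
      (∀ i : I, ¬ IsMin i → ∃ j, j ⋖ i) ∧ ∀ i : I, ¬ IsMax i → ∃ j, i ⋖ j := by
  rcases finite_or_infinite I with hI | hI
  · obtain ⟨_, _⟩ := exists_wellFoundedLT I
    exact ⟨inferInstance, fun i hi => exists_covBy_of_wellFoundedGT hi,
      fun i hi => exists_covBy_of_wellFoundedLT hi⟩
  · obtain ⟨f, hf, hcov⟩ := exists_injective_forall_exists_covBy I
    let _ : LinearOrder I := LinearOrder.lift' f hf
    let e : I ↪o Ordinal.{u} ×ₗ ℤ := ⟨⟨f, hf⟩, Iff.rfl⟩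
    exact ⟨inferInstance, fun i _ => (hcov i).1.imp fun _ => CovBy.of_image e,
      fun i _ => (hcov i).2.imp fun _ => CovBy.of_image e⟩

end DiscreteOrder

section LexicographicOrder

variable {X : Type u} [TopologicalSpace X] {ι : Type v} [LinearOrder ι] {M : Type w}
  [LinearOrder M] {f : X → ι → M}

lemma isOpen_toLex_lt (hf : ∀ x i, {y | ∀ j ≤ i, f y j = f x j} ∈ 𝓝 x) (a : ι → M) :
    IsOpen {y | toLex (f y) < toLex a} := isOpen_iff_mem_nhds.2 fun y ⟨i, heq, hlt⟩ => by
  filter_upwards [hf y i] with z hz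
  exact ⟨i, fun j hj => (hz j hj.le).trans (heq j hj), (hz i le_rfl).trans_lt hlt⟩

lemma isOpen_lt_toLex (hf : ∀ x i, {y | ∀ j ≤ i, f y j = f x j} ∈ 𝓝 x) (a : ι → M) :
    IsOpen {y | toLex a < toLex (f y)} := isOpen_iff_mem_nhds.2 fun y ⟨i, heq, hlt⟩ => by
  filter_upwards [hf y i] with z hz
  exact ⟨i, fun j hj => (heq j hj).trans (hz j hj.le).symm, hlt.trans_eq (hz i le_rfl).symm⟩

lemma eqOn_Iio_of_toLex_le [WellFoundedLT ι] {a b c : ι → M} {i : ι} (hac : EqOn a c (Iio i))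
    (hab : toLex a ≤ toLex b) (hbc : toLex b ≤ toLex c) : EqOn b c (Iio i) := by
  intro j
  induction j using WellFoundedLT.induction with
  | ind j ih =>
    intro hj
    have hbelow (k : ι) (hk : k < j) : b k = c k := ih k hk (hk.trans hj)
    refine le_antisymm (not_lt.1 fun h => ?_) (not_lt.1 fun h => ?_)
    · exact hbc.not_gt ⟨j, fun k hk => (hbelow k hk).symm, h⟩
    · exact hab.not_gt ⟨j, fun k hk => (hbelow k hk).trans (hac (hk.trans hj)).symm,
        h.trans_eq (hac hj).symm⟩

variable [WellFoundedLT ι]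

/-- If no class has a least or greatest element, then the classes are neighborhoods in the
lexicographic order, being convex. -/
lemma IsPartitionBase.isTopologicallyOrderable_of_agreeBelow [T0Space X] [NoMaxOrder ι]
    (h : IsPartitionBase (agreeBelow f))
    (hlt : ∀ i x, ∃ y, agreeBelow f i y x ∧ f y i < f x i)
    (hgt : ∀ i x, ∃ y, agreeBelow f i y x ∧ f x i < f y i) : IsTopologicallyOrderable X := by
  have hf (x : X) (i : ι) : {y | ∀ j ≤ i, f y j = f x j} ∈ 𝓝 x := by
    obtain ⟨k, hk⟩ := exists_gt i
    filter_upwards [h.class_mem_nhds k x] with y hy j hj using hy j (hj.trans_lt hk)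
  have hinj : (toLex ∘ f).Injective := fun x y hxy => by
    by_contra hne
    obtain ⟨i, hi⟩ := h.exists_not_rel hne
    exact hi fun j _ => congrFun (toLex.injective hxy).symm j
  let _ : LinearOrder X := LinearOrder.lift' _ hinj
  have : ClosedIciTopology X := ⟨fun a => by
    rw [← isOpen_compl_iff, compl_Ici]; exact isOpen_toLex_lt hf (f a)⟩
  have : ClosedIicTopology X := ⟨fun a => by
    rw [← isOpen_compl_iff, compl_Iic]; exact isOpen_lt_toLex hf (f a)⟩
  refine ⟨inferInstance, orderTopology_of_exists_Ioc_Ico_subset (fun x U hU _ => ?_)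
    fun x U hU _ => ?_⟩ <;> obtain ⟨i, -, hi⟩ := (h.hasBasis x).mem_iff.1 hU
  · obtain ⟨l, hl, hlx⟩ := hlt i x
    exact ⟨l, ⟨i, hl, hlx⟩, fun y hy => hi (eqOn_Iio_of_toLex_le hl hy.1.le hy.2)⟩
  · obtain ⟨r, hr, hxr⟩ := hgt i x
    have hrx : EqOn (f x) (f r) (Iio i) := fun j hj => (hr j hj).symm
    exact ⟨r, ⟨i, hrx, hxr⟩, fun y hy => hi fun j hj =>
      (eqOn_Iio_of_toLex_le hrx hy.1 hy.2.le hj).trans (hr j hj)⟩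

lemma isTopologicallyOrderable_of_isCompact_fiber (hinj : f.Injective)
    (hf : ∀ x i, {y | ∀ j ≤ i, f y j = f x j} ∈ 𝓝 x) {I : Type u} {q : X → I}
    (hq : IsLocallyConstant q) (hsurj : q.Surjective) (hcomp : ∀ i, IsCompact (q ⁻¹' {i})) :
    IsTopologicallyOrderable X := by
  obtain ⟨_, hpred, hsucc⟩ := exists_linearOrder_forall_exists_covBy I
  let F (x : X) : I ×ₗ Lex (ι → M) := toLex (q x, toLex (f x))
  have hF : F.Injective := fun x y hxy =>
    hinj (toLex.injective (congrArg Prod.snd (toLex.injective hxy)))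
  let _ : LinearOrder X := LinearOrder.lift' F hF
  have lt_iff {x y : X} : x < y ↔ q x < q y ∨ q x = q y ∧ toLex (f x) < toLex (f y) :=
    Prod.Lex.toLex_lt_toLex
  have hmono : Monotone q := fun x y hxy => by
    rcases hxy.lt_or_eq with h | rfl
    · exact (lt_iff.1 h).elim le_of_lt fun h => h.1.le
    · exact le_rfl
  have : ClosedIciTopology X := ⟨fun a => by
    rw [← isOpen_compl_iff, compl_Ici]
    convert (hq (Iio (q a))).union ((hq {q a}).inter (isOpen_toLex_lt hf (f a))) using 1
    exact Set.ext fun y => lt_iff⟩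
  have : ClosedIicTopology X := ⟨fun a => by
    rw [← isOpen_compl_iff, compl_Iic]
    convert (hq (Ioi (q a))).union ((hq {q a}).inter (isOpen_lt_toLex hf (f a))) using 1
    exact Set.ext fun y => lt_iff.trans (or_congr_right (and_congr_left' eq_comm))⟩
  exact ⟨inferInstance, orderTopology_of_exists_Ioc_Ico_subset
    (fun x U hU => exists_Ioc_subset_of_isCompact_fiber hmono hsurj hcomp hpred hU)
    fun x U hU => exists_Ico_subset_of_isCompact_fiber hmono hsurj hcomp hsucc hU⟩

end LexicographicOrder

section OrderabilityOfPartitionBases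

variable {X : Type u} [TopologicalSpace X] {ι : Type v} [LinearOrder ι] {r : ι → Setoid X}

lemma IsPartitionBase.noMaxOrder [Nonempty X] (h : IsPartitionBase r)
    (hX : ∀ x : X, ∀ K ∈ 𝓝 x, ¬ IsCompact K) : NoMaxOrder ι := by
  refine ⟨fun m => ?_⟩
  by_contra! hm
  obtain ⟨x⟩ := ‹Nonempty X›
  refine hX x _ (h.class_mem_nhds m x) (isCompact_of_finite_subcover fun U hU hcover => ?_)
  obtain ⟨k, hk⟩ := mem_iUnion.1 (hcover ((r m).refl x))
  obtain ⟨i, -, hi⟩ := (h.hasBasis x).mem_iff.1 ((hU k).mem_nhds hk)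
  exact ⟨{k}, fun y hy =>
    mem_iUnion₂.2 ⟨k, Finset.mem_singleton_self k, hi (h.antitone (hm i) hy)⟩⟩

variable [WellFoundedLT ι]

lemma IsUltraparacompact.exists_isLocallyConstant_isCompact_fiber [WeaklyLocallyCompactSpace X]
    (h : IsUltraparacompact X) :
    ∃ q : X → Set X, IsLocallyConstant q ∧ ∀ x, IsCompact (q ⁻¹' {q x}) := by
  obtain ⟨q, hq, hmem⟩ := h {U | IsOpen U ∧ ∃ K, IsCompact K ∧ U ⊆ K} (fun U hU => hU.1)
    (eq_univ_of_forall fun x => by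
      obtain ⟨K, hK, hKx⟩ := exists_compact_mem_nhds x
      exact ⟨interior K, ⟨isOpen_interior, K, hK, interior_subset⟩,
        mem_interior_iff_mem_nhds.2 hKx⟩)
  refine ⟨q, hq, fun x => ?_⟩
  obtain ⟨⟨-, K, hK, hqK⟩, -⟩ := hmem x
  refine hK.of_isClosed_subset (hq.isClosed_fiber (q x)) fun y hy => hqK ?_
  exact (show q y = q x from hy) ▸ (hmem y).2

lemma IsPartitionBase.isTopologicallyOrderable_of_weaklyLocallyCompactSpace [T0Space X]
    [WeaklyLocallyCompactSpace X] (h : IsPartitionBase r) : IsTopologicallyOrderable X := by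
  obtain ⟨q, hq, hcomp⟩ := h.isUltraparacompact.exists_isLocallyConstant_isCompact_fiber
  obtain ⟨_, -⟩ := exists_wellFoundedLT (Set X)
  refine isTopologicallyOrderable_of_isCompact_fiber (f := fun x i => {z | r i z x})
    (q := rangeFactorization q) (fun x y hxy => ?_) (fun x i => ?_) ?_
    rangeFactorization_surjective ?_
  · by_contra hne
    obtain ⟨i, hi⟩ := h.exists_not_rel hne
    have hclass : {z | r i z x} = {z | r i z y} := congrFun hxy i
    exact hi (hclass.ge ((r i).refl y))
  · filter_upwards [h.class_mem_nhds i x] with y hy j hj using setoid_class_eq (h.antitone hj hy)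
  · refine (IsLocallyConstant.iff_eventually_eq _).2 fun x => ?_
    filter_upwards [hq.eventually_eq x] with y hy using Subtype.ext hy
  · rintro ⟨_, x, rfl⟩
    convert hcomp x using 1
    exact Set.ext fun y => Subtype.ext_iff

lemma IsPartitionBase.exists_isRegularCardinalOrder (h : IsPartitionBase r) :
    ∃ s : Set ι, Nonempty (IsRegularCardinalOrder s) ∧ IsPartitionBase fun i : s => r i := by
  obtain ⟨s, hs, htype⟩ := Ordinal.exists_ord_cof_eq ι
  refine ⟨s, ⟨⟨?_⟩⟩, h.comp (Subtype.mono_coe s) fun i => ?_⟩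
  · rw [Order.cof_eq_of_isCofinal hs, htype]
  · obtain ⟨j, hj, hij⟩ := hs i
    exact ⟨⟨j, hj⟩, hij⟩

lemma IsPartitionBase.biInter_mem_nhds [IsRegularCardinalOrder ι] (h : IsPartitionBase r) (i : ι)
    {x : X} {N : ι → Set X} (hN : ∀ j < i, N j ∈ 𝓝 x) : ⋂ j < i, N j ∈ 𝓝 x := by
  choose k hk using fun j : Iio i => (h.hasBasis x).mem_iff.1 (hN j j.2)
  have hcard : Cardinal.mk (range k) < Order.cof ι := Order.cof_eq_cardinalMk (α := ι) ▸
    Cardinal.mk_range_le.trans_lt (Cardinal.mk_Iio_lt i Cardinal.ord_cardinalMk)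
  obtain ⟨b, hb⟩ := BddAbove.of_not_isCofinal fun hcof => (Order.cof_le hcof).not_gt hcard
  refine Filter.mem_of_superset (h.class_mem_nhds b x) fun y hy => mem_iInter₂.2 fun j hj => ?_
  exact (hk ⟨j, hj⟩).2 (h.antitone (hb (mem_range_self _)) hy)

lemma IsUltraparacompact.exists_isLocallyConstant_infinite_image (h : IsUltraparacompact X)
    {A : Set X} (hA : IsClosed A) (hnc : ¬ IsCompact A) :
    ∃ c : X → Set X, IsLocallyConstant c ∧ (c '' A).Infinite := by
  contrapose! hnc
  refine isCompact_of_finite_subcover fun {κ} U hU hcover => ?_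
  obtain ⟨c, hc, hmem⟩ := h (insert Aᶜ (range U))
    (by rintro _ (rfl | ⟨k, rfl⟩); exacts [hA.isOpen_compl, hU k])
    (eq_univ_of_forall fun x => by
      by_cases hx : x ∈ A
      · obtain ⟨k, hk⟩ := mem_iUnion.1 (hcover hx)
        exact ⟨U k, Or.inr ⟨k, rfl⟩, hk⟩
      · exact ⟨Aᶜ, Or.inl rfl, hx⟩)
  have hrange : c '' A ⊆ U '' univ := by
    rintro _ ⟨x, hx, rfl⟩
    rw [image_univ]
    exact (hmem x).1.resolve_left fun heq => (heq ▸ (hmem x).2 : x ∈ Aᶜ) hx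
  obtain ⟨t, -, ht, heq⟩ := exists_subset_image_finite_and.1
    ⟨c '' A, hrange, hnc c hc, rfl⟩
  refine ⟨ht.toFinset, fun x hx => ?_⟩
  obtain ⟨k, hk, hkx⟩ : c x ∈ U '' t := heq ▸ mem_image_of_mem c hx
  exact mem_iUnion₂.2 ⟨k, ht.mem_toFinset.2 hk, hkx ▸ (hmem x).2⟩

/-- A locally constant labelling that separates the points of different classes of `s` in `A` and
attains neither a least nor a greatest label on `A`. -/
structure IsSplitting {M : Type w} [LT M] (s : Setoid X) (A : Set X) (l : X → M) : Prop where
  isLocallyConstant : IsLocallyConstant l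
  rel_of_eq : ∀ x ∈ A, ∀ y ∈ A, l y = l x → s y x
  exists_lt : ∀ x ∈ A, ∃ y ∈ A, l y < l x
  exists_gt : ∀ x ∈ A, ∃ y ∈ A, l x < l y

lemma IsUltraparacompact.exists_isSplitting (h : IsUltraparacompact X) {s : Setoid X}
    (hs : ∀ x, {y | s y x} ∈ 𝓝 x) {A : Set X} (hA : IsClosed A) (hnc : ¬ IsCompact A) :
    ∃ l : X → Ordinal.{u} ×ₗ ℤ, IsSplitting s A l := by
  obtain ⟨c, hc, hinf⟩ := h.exists_isLocallyConstant_infinite_image hA hnc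
  let d (x : X) : Set X × Quotient s := (c x, Quotient.mk s x)
  have hd : IsLocallyConstant d := (IsLocallyConstant.iff_eventually_eq d).2 fun x => by
    filter_upwards [hc.eventually_eq x, hs x] with y hcy hsy
    exact Prod.ext hcy (Quotient.sound hsy)
  have : Infinite (d '' A) := infinite_coe_iff.2 fun hfin => hinf (by
    have := hfin.image Prod.fst
    rwa [image_image] at this)
  obtain ⟨e, he, hcov⟩ := exists_injective_forall_exists_covBy (d '' A)
  let l : X → Ordinal.{u} ×ₗ ℤ := Function.extend Subtype.val e 0 ∘ d
  have hl {x : X} (hx : x ∈ A) : l x = e ⟨d x, mem_image_of_mem d hx⟩ :=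
    Subtype.val_injective.extend_apply e 0 ⟨d x, mem_image_of_mem d hx⟩
  refine ⟨l, hd.comp _, fun x hx y hy hxy => ?_, fun x hx => ?_, fun x hx => ?_⟩
  · rw [hl hx, hl hy] at hxy
    exact Quotient.exact (congrArg Prod.snd (congrArg Subtype.val (he hxy)))
  · obtain ⟨⟨_, y, hy, rfl⟩, hyx⟩ := (hcov ⟨d x, mem_image_of_mem d hx⟩).1
    exact ⟨y, hy, by rw [hl hx, hl hy]; exact hyx.lt⟩
  · obtain ⟨⟨_, y, hy, rfl⟩, hxy⟩ := (hcov ⟨d x, mem_image_of_mem d hx⟩).2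
    exact ⟨y, hy, by rw [hl hx, hl hy]; exact hxy.lt⟩

lemma exists_forall_eq_agreeBelow {X : Type u} {M : Type w} (lab : ι → Set X → X → M) :
    ∃ f : X → ι → M, ∀ x i, f x i = lab i {y | agreeBelow f i y x} x := by
  let step (i : ι) (ih : ∀ j < i, X → M) (x : X) : M :=
    lab i {y | ∀ j (hj : j < i), ih j hj y = ih j hj x} x
  exact ⟨fun x i => wellFounded_lt.fix step i x,
    fun x i => congrFun (wellFounded_lt.fix_eq step i) x⟩

lemma agreeBelow_mem_nhds {M : Type w} {lab : ι → Set X → X → M} {f : X → ι → M}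
    (hf : ∀ x i, f x i = lab i {y | agreeBelow f i y x} x)
    (hlab : ∀ i A, IsClopen A → A.Nonempty → IsLocallyConstant (lab i A))
    (hinter : ∀ i x, ∀ N : ι → Set X, (∀ j < i, N j ∈ 𝓝 x) → ⋂ j < i, N j ∈ 𝓝 x)
    (i : ι) (x : X) : {y | agreeBelow f i y x} ∈ 𝓝 x := by
  induction i using WellFoundedLT.induction generalizing x with
  | ind i ih =>
    refine Filter.mem_of_superset (hinter i x (fun j => {y | f y j = f x j}) fun j hj => ?_)
      fun y hy j hj => mem_iInter₂.1 hy j hj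
    have hconst := hlab j _ (isClopen_setoid_class (ih j hj) x) ⟨x, (agreeBelow f j).refl x⟩
    filter_upwards [ih j hj x, hconst.eventually_eq x] with y hy hyx
    rw [hf y, hf x, setoid_class_eq hy, hyx]

lemma IsPartitionBase.exists_isPartitionBase_agreeBelow [IsRegularCardinalOrder ι] [NoMaxOrder ι]
    {M : Type w} [LT M] [Nonempty M] (h : IsPartitionBase r)
    (hsplit : ∀ i A, IsClopen A → A.Nonempty → ∃ l : X → M, IsSplitting (r i) A l) :
    ∃ f : X → ι → M, IsPartitionBase (agreeBelow f) ∧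
      ∀ i x, (∃ y, agreeBelow f i y x ∧ f y i < f x i) ∧
        ∃ y, agreeBelow f i y x ∧ f x i < f y i := by
  choose! lab hlab using hsplit
  obtain ⟨f, hf⟩ := exists_forall_eq_agreeBelow lab
  have hnhds := agreeBelow_mem_nhds hf (fun i A hA hne => (hlab i A hA hne).isLocallyConstant)
    fun i x N => h.biInter_mem_nhds i
  have hself (i : ι) (x : X) : x ∈ {y | agreeBelow f i y x} := (agreeBelow f i).refl x
  have hlab' (i : ι) (x : X) := hlab i _ (isClopen_setoid_class (hnhds i) x) ⟨x, hself i x⟩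
  have hf' {i : ι} {x y : X} (hyx : agreeBelow f i y x) :
      f y i = lab i {y | agreeBelow f i y x} y := by
    rw [hf, setoid_class_eq hyx]
  have hrel {i k : ι} (hik : i < k) {x y : X} (hyx : agreeBelow f k y x) : r i y x := by
    have hyx' : agreeBelow f i y x := antitone_agreeBelow f hik.le hyx
    exact (hlab' i x).rel_of_eq x (hself i x) y hyx' (hf' hyx' ▸ hf x i ▸ hyx i hik)
  refine ⟨f, ⟨antitone_agreeBelow f, fun x => (h.hasBasis x).to_hasBasis (fun i _ => ?_)
    fun i _ => ?_⟩, fun i x => ⟨?_, ?_⟩⟩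
  · obtain ⟨k, hik⟩ := exists_gt i
    exact ⟨k, trivial, fun y hy => hrel hik hy⟩
  · obtain ⟨k, -, hk⟩ := (h.hasBasis x).mem_iff.1 (hnhds i x)
    exact ⟨k, trivial, hk⟩
  · obtain ⟨y, hy, hlt⟩ := (hlab' i x).exists_lt x (hself i x)
    exact ⟨y, hy, by rwa [hf' hy, hf x i]⟩
  · obtain ⟨y, hy, hlt⟩ := (hlab' i x).exists_gt x (hself i x)
    exact ⟨y, hy, by rwa [hf' hy, hf x i]⟩

lemma IsPartitionBase.isTopologicallyOrderable_of_forall_not_isCompact [T0Space X]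
    [Nonempty X] (h : IsPartitionBase r) (hX : ∀ x : X, ∀ K ∈ 𝓝 x, ¬ IsCompact K) :
    IsTopologicallyOrderable X := by
  obtain ⟨s, ⟨_⟩, hs⟩ := h.exists_isRegularCardinalOrder
  have := hs.noMaxOrder hX
  obtain ⟨f, hf, hf'⟩ := hs.exists_isPartitionBase_agreeBelow fun i A hA ⟨x, hx⟩ =>
    h.isUltraparacompact.exists_isSplitting (hs.class_mem_nhds i) hA.isClosed
      (hX x A (hA.isOpen.mem_nhds hx))
  exact hf.isTopologicallyOrderable_of_agreeBelow (fun i x => (hf' i x).1) fun i x => (hf' i x).2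

end OrderabilityOfPartitionBases

namespace Gyrogroup

variable {G : Type u} [Gyrogroup G] [TopologicalSpace G] [ContinuousAdd G]

lemma weaklyLocallyCompactSpace_of_mem_nhds {K : Set G} (hK : IsCompact K) {a : G}
    (ha : K ∈ 𝓝 a) : WeaklyLocallyCompactSpace G where
  exists_compact_mem_nhds x := by
    let e : G ≃ₜ G := (leftHomeomorph a).symm.trans (leftHomeomorph x)
    have he : e a = x := by
      change x + (-a + a) = x
      rw [neg_add', add_zero']
    exact ⟨e '' K, hK.image e.continuous, he ▸ e.isOpenMap.image_mem_nhds ha⟩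

lemma isTopologicallyOrderable_of_isPartitionBase [T0Space G] {ι : Type v} [LinearOrder ι]
    [WellFoundedLT ι] {r : ι → Setoid G} (h : IsPartitionBase r) : IsTopologicallyOrderable G := by
  by_cases hK : ∃ a : G, ∃ K ∈ 𝓝 a, IsCompact K
  · obtain ⟨a, K, hKa, hK⟩ := hK
    have := weaklyLocallyCompactSpace_of_mem_nhds hK hKa
    exact h.isTopologicallyOrderable_of_weaklyLocallyCompactSpace
  · push Not at hK
    have : Nonempty G := ⟨0⟩
    exact h.isTopologicallyOrderable_of_forall_not_isCompact hK

end Gyrogroup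

section OrderConvexNeighborhoods

variable {X : Type u} [LinearOrder X] [TopologicalSpace X] [OrderTopology X]

lemma setOf_not_covBy_mem_nhds (a : X) : {x | ¬ x ⋖ a ∧ ¬ a ⋖ x} ∈ 𝓝 a := by
  have hl : {x | x ⋖ a}.Subsingleton := fun x hx y hy => hx.unique_left hy
  have hr : {x | a ⋖ x}.Subsingleton := fun x hx y hy => hx.unique_right hy
  exact Filter.inter_mem (hl.finite.isClosed.isOpen_compl.mem_nhds fun h => h.ne rfl)
    (hr.finite.isClosed.isOpen_compl.mem_nhds fun h => h.ne rfl)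

lemma nhds_eq_iInf_principal_of_ordConnected {ι : Sort v} {O : ι → Set X} {a : X}
    (hO : ∀ i, O i ∈ 𝓝 a) (hconn : ∀ i, (O i).OrdConnected) (hinter : ⋂ i, O i = {a}) :
    𝓝 a = ⨅ i, Filter.principal (O i) := by
  refine le_antisymm (le_iInf fun i => Filter.le_principal_iff.2 (hO i)) ?_
  have hmem {b : X} (hb : b ≠ a) : ∃ i, b ∉ O i := by
    have hb' : b ∉ ⋂ i, O i := by rwa [hinter, mem_singleton_iff]
    exact not_forall.1 fun h => hb' (mem_iInter.2 h)
  rw [nhds_eq_order]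
  refine le_inf (le_iInf₂ fun b hba => ?_) (le_iInf₂ fun b hab => ?_)
  · obtain ⟨i, hi⟩ := hmem hba.ne
    exact iInf_le_of_le i <| Filter.principal_mono.2 fun x hx => lt_of_not_ge fun hxb =>
      hi ((hconn i).out hx (mem_of_mem_nhds (hO i)) ⟨hxb, hba.le⟩)
  · obtain ⟨i, hi⟩ := hmem hab.ne'
    exact iInf_le_of_le i <| Filter.principal_mono.2 fun x hx => lt_of_not_ge fun hbx =>
      hi ((hconn i).out (mem_of_mem_nhds (hO i)) hx ⟨hab.le, hbx⟩)

end OrderConvexNeighborhoods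

section Filter

variable {X : Type u} {l : Filter X}

lemma exists_iInter_notMem_cardinalInterFilter (h : ⋂₀ l.sets ∉ l) :
    ∃ (ι : Type u) (N : ι → Set X), (∀ i, N i ∈ l) ∧ ⋂ i, N i ∉ l ∧
      CardinalInterFilter l (Cardinal.mk ι) := by
  let B : Set (Set (Set X)) := {S | S ⊆ l.sets ∧ ⋂₀ S ∉ l}
  have hB : B.Nonempty := ⟨l.sets, Subset.rfl, h⟩
  let S : Set (Set X) := Function.argminOn (fun S => Cardinal.mk S) B hB
  obtain ⟨hS, hSl⟩ : S ∈ B := Function.argminOn_mem _ B hB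
  refine ⟨S, Subtype.val, fun s => hS s.2, sInter_eq_iInter ▸ hSl, ⟨fun T hT hTl => ?_⟩⟩
  by_contra hnot
  exact Function.not_lt_argminOn (fun S : Set (Set X) => Cardinal.mk S) B ⟨hTl, hnot⟩ hT

lemma isCountablyGenerated_of_sInter_sets_mem (h : ⋂₀ l.sets ∈ l) : l.IsCountablyGenerated := by
  have hl : l = Filter.principal (⋂₀ l.sets) :=
    le_antisymm (Filter.le_principal_iff.2 h) fun _ hU => sInter_subset_of_mem hU
  rw [hl]
  infer_instance

end Filter

namespace Gyrogroup

variable {G : Type u} [Gyrogroup G] [TopologicalSpace G]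

section ContinuousAdd

variable [ContinuousAdd G]

lemma isPartitionBase_leftCosetSetoid {ι : Type v} [Preorder ι] {H : ι → Set G}
    (hH : ∀ i, IsInvariantSubgyrogroup (H i)) (hanti : Antitone H)
    (hbasis : (𝓝 (0 : G)).HasBasis (fun _ => True) H) :
    IsPartitionBase fun i => (hH i).leftCosetSetoid where
  antitone _ _ hij _ _ h := hanti hij h
  hasBasis x := nhds_eq_comap x ▸ hbasis.comap _

variable [LinearOrder G] [OrderTopology G]

lemma IsInvariantSubgyrogroup.eq_zero_of_not_covBy {H : Set G} (hH : IsInvariantSubgyrogroup H)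
    (hconn : H.OrdConnected) (hnhds : H ∉ 𝓝 (0 : G)) {x : G} (hx : x ∈ H)
    (hcov : ¬ x ⋖ 0 ∧ ¬ 0 ⋖ x) : x = 0 := by
  have hno {a b c : G} (ha : a ∈ H) (hb : b ∈ H) (hac : a < c) (hcb : c < b) : False :=
    hnhds (hH.mem_nhds_zero (hconn.out ha hb ⟨hac.le, hcb.le⟩)
      (Filter.mem_of_superset (Icc_mem_nhds hac hcb) (hconn.out ha hb)))
  rcases lt_trichotomy x 0 with h | h | h
  · exact (hcov.1 ⟨h, fun _ => hno hx hH.zero_mem⟩).elim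
  · exact h
  · exact (hcov.2 ⟨h, fun _ => hno hH.zero_mem hx⟩).elim

end ContinuousAdd

variable [IsStronglyTopologicalGyrogroup G] [LinearOrder G] [OrderTopology G]

lemma exists_seq_ordConnected_nhds {U : Set G} (hU : U ∈ 𝓝 (0 : G)) :
    ∃ O : ℕ → Set G, O 0 ⊆ U ∧ (∀ n, O n ∈ 𝓝 (0 : G)) ∧ (∀ n, (O n).OrdConnected) ∧
      IsInvariantSubgyrogroup (⋂ n, O n) := by
  let C (V : Set G) : Set G := ordConnectedComponent V 0
  have hC {V : Set G} (hV : V ∈ 𝓝 (0 : G)) : C V ∈ 𝓝 (0 : G) := ordConnectedComponent_mem_nhds.2 hV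
  choose! W hW hWV using fun (V : Set G) (hV : V ∈ 𝓝 (0 : G)) => exists_operationsMapInto hV
  let O (n : ℕ) : Set G := (C ∘ W)^[n] (C U)
  have hsucc (n : ℕ) : O (n + 1) = C (W (O n)) := Function.iterate_succ_apply' _ _ _
  have hO (n : ℕ) : O n ∈ 𝓝 (0 : G) := by
    induction n with
    | zero => exact hC hU
    | succ n ih => exact hsucc n ▸ hC (hW _ ih)
  refine ⟨O, ordConnectedComponent_subset, hO, fun n => ?_,
    .iInter_of_operationsMapInto_succ (fun n => mem_of_mem_nhds (hO n)) fun n => ?_⟩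
  · obtain ⟨V, hV⟩ : ∃ V, O n = C V := by
      cases n with
      | zero => exact ⟨U, rfl⟩
      | succ n => exact ⟨_, hsucc n⟩
    exact hV ▸ inferInstanceAs (ordConnectedComponent V 0).OrdConnected
  · exact hsucc n ▸ (hWV _ (hO n)).mono ordConnectedComponent_subset Subset.rfl

/-- The intersection of all `O i n` is an order-convex invariant subgyrogroup with empty interior
that avoids the immediate neighbors of `0`, hence trivial. -/
lemma exists_ordConnected_nhds_iInter_eq_singleton {ι : Type v} {N : ι → Set G}
    (hN : ∀ i, N i ∈ 𝓝 (0 : G)) (hinter : ⋂ i, N i ∉ 𝓝 (0 : G)) :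
    ∃ O : ι → ℕ → Set G, (∀ i n, O i n ∈ 𝓝 (0 : G)) ∧ (∀ i n, (O i n).OrdConnected) ∧
      (∀ i, IsInvariantSubgyrogroup (⋂ n, O i n)) ∧ ⋂ i, ⋂ n, O i n = {0} := by
  choose O hsub hO hconn hH using fun i =>
    exists_seq_ordConnected_nhds (Filter.inter_mem (hN i) (setOf_not_covBy_mem_nhds (0 : G)))
  have hsub' (i : ι) : ⋂ n, O i n ⊆ N i ∩ _ := (iInter_subset _ 0).trans (hsub i)
  have hK : IsInvariantSubgyrogroup (⋂ i, ⋂ n, O i n) := .iInter hH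
  refine ⟨O, hO, hconn, hH, eq_singleton_iff_unique_mem.2 ⟨hK.zero_mem, fun x hx => ?_⟩⟩
  obtain ⟨i⟩ : Nonempty ι := by
    by_contra! hempty
    exact hinter (by rw [iInter_of_empty]; exact Filter.univ_mem)
  refine hK.eq_zero_of_not_covBy (ordConnected_iInter fun i => ordConnected_iInter (hconn i))
    (fun h => hinter (Filter.mem_of_superset h ?_)) hx (hsub' i (mem_iInter.1 hx i)).2
  exact iInter_mono fun i => (hsub' i).trans inter_subset_left

lemma isCountablyGenerated_nhds_zero {ι : Type v} [Countable ι] {N : ι → Set G}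
    (hN : ∀ i, N i ∈ 𝓝 (0 : G)) (hinter : ⋂ i, N i ∉ 𝓝 (0 : G)) :
    (𝓝 (0 : G)).IsCountablyGenerated := by
  obtain ⟨O, hO, hconn, -, hO0⟩ := exists_ordConnected_nhds_iInter_eq_singleton hN hinter
  rw [nhds_eq_iInf_principal_of_ordConnected (O := fun p : ι × ℕ => O p.1 p.2)
    (fun p => hO p.1 p.2) (fun p => hconn p.1 p.2) ((iInf_prod' O).symm.trans hO0)]
  infer_instance

lemma hasWellOrderedClopenPartitionBase_of_uncountable {ι : Type u} [Uncountable ι]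
    [CardinalInterFilter (𝓝 (0 : G)) (Cardinal.mk ι)] {N : ι → Set G}
    (hN : ∀ i, N i ∈ 𝓝 (0 : G)) (hinter : ⋂ i, N i ∉ 𝓝 (0 : G)) :
    HasWellOrderedClopenPartitionBase G := by
  obtain ⟨O, hO, hconn, hOH, hO0⟩ := exists_ordConnected_nhds_iInter_eq_singleton hN hinter
  have hcard : Cardinal.aleph0 < Cardinal.mk ι := Cardinal.aleph0_lt_mk_iff.2 inferInstance
  have := CardinalInterFilter.toCountableInterFilter (𝓝 (0 : G)) hcard
  obtain ⟨_, _, htype⟩ := Cardinal.exists_ord_eq_type_lt ι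
  let H (i : ι) : Set G := ⋂ j : Iic i, ⋂ n, O j n
  have hH (i : ι) : IsInvariantSubgyrogroup (H i) := .iInter fun j => hOH j
  have hHO (i : ι) : H i ⊆ ⋂ n, O i n := iInter_subset_of_subset ⟨i, le_rfl⟩ Subset.rfl
  have hanti : Antitone H := fun i j hij =>
    subset_iInter fun k => iInter_subset_of_subset ⟨k, k.2.trans hij⟩ Subset.rfl
  have hnhds (i : ι) : H i ∈ 𝓝 (0 : G) :=
    (Filter.cardinal_iInter_mem (Cardinal.mk_Iic_lt i htype hcard.le)).2 fun j =>
      countable_iInter_mem.2 (hO j)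
  have hH0 : ⋂ i, H i = {0} := Subset.antisymm ((iInter_mono hHO).trans_eq hO0)
    (singleton_subset_iff.2 (mem_iInter.2 fun i => (hH i).zero_mem))
  have hbasis : (𝓝 (0 : G)).HasBasis (fun _ => True) H := by
    rw [nhds_eq_iInf_principal_of_ordConnected hnhds (fun i => ordConnected_iInter fun j =>
      ordConnected_iInter (hconn j)) hH0]
    exact Filter.hasBasis_iInf_principal hanti.directed_ge
  exact (isPartitionBase_leftCosetSetoid hH hanti hbasis).hasWellOrderedClopenPartitionBase

lemma hasWellOrderedClopenPartitionBase_of_orderTopology [TotallyDisconnectedSpace G] :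
    HasWellOrderedClopenPartitionBase G := by
  by_cases hcg : (𝓝 (0 : G)).IsCountablyGenerated
  · have := pseudoMetrizableSpace_of_isCountablyGenerated (G := G)
    let _ := TopologicalSpace.pseudoMetrizableSpacePseudoMetric G
    exact IsUltraparacompact.hasWellOrderedClopenPartitionBase
      (isUltraparacompact_of_exists_isClopen_between fun A U hA hU => exists_isClopen_between hA hU)
  · obtain ⟨ι, N, hN, hinter, _⟩ := exists_iInter_notMem_cardinalInterFilter (l := 𝓝 (0 : G))
      (mt isCountablyGenerated_of_sInter_sets_mem hcg)
    by_cases hι : Countable ι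
    · exact (hcg (isCountablyGenerated_nhds_zero hN hinter)).elim
    · rw [not_countable_iff] at hι
      exact hasWellOrderedClopenPartitionBase_of_uncountable hN hinter

end Gyrogroup

theorem theorem3p7 {G : Type u} [Gyrogroup G] [TopologicalSpace G]
    [IsStronglyTopologicalGyrogroup G] [T0Space G] :
    List.TFAE [
      IsTopologicallyOrderable G ∧ TotallyDisconnectedSpace G,
      IsTopologicallyOrderable G ∧ coveringDim G = 0,
      HasWellOrderedClopenPartitionBase G] := by
  have : Nonempty G := ⟨0⟩
  tfae_have 1 → 3
  | ⟨⟨_, _⟩, _⟩ => Gyrogroup.hasWellOrderedClopenPartitionBase_of_orderTopology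
  tfae_have 3 → 2
  | h => by
    obtain ⟨α, r, hr⟩ := h.exists_isPartitionBase
    exact ⟨Gyrogroup.isTopologicallyOrderable_of_isPartitionBase hr,
      coveringDim_eq_zero_iff.2 hr.isUltraparacompact.coveringDimLE_zero⟩
  tfae_have 2 → 1
  | ⟨⟨o, ho⟩, hdim⟩ => by
    have := (coveringDim_eq_zero_iff.1 hdim).totallySeparatedSpace
    exact ⟨⟨o, ho⟩, inferInstance⟩
  tfae_finish
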